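/- **Setting.** Let $\mathcal H$ be a complex Hilbert space, $\mathcal D\subseteq\mathcal H$ a dense subspace, and $U\subseteq\mathbb C$ an open neighbourhood of $0$. For every $t\in U$ let $\mathfrak a(t)$ be a closed sectorial sesquilinear form with domain $\mathcal D$, such that $t\mapsto\mathfrak a(t)[x,y]$ is holomorphic on $U$ for all $x,y\in\mathcal D$ (a holomorphic family of type (a)), and such that $\mathfrak a(t)$ is symmetric for every real $t\in U$. For every real $t\in U$ let $A(t)$ be the self-adjoint operator corresponding to $\mathfrak a(t)$, i.e. the domain of $A(t)$ is a core of $\mathfrak a(t)$ and $\langle A(t)x,y\rangle=\mathfrak a(t)[x,y]$ for all $x,y$ in the domain of $A(t)$. Then $A(t)$ is called a self-adjoint holomorphic family of type (B). Here a form $\mathfrak s$ is sectorial if there are $v\in\mathbb C$ and $\theta<\pi/2$ with $|\arg(\mathfrak s[x,x]-v)|\le\theta$ for all unit vectors $x$ in its domain (with $\arg 0=0$). A sectorial form $\mathfrak s$ is closed if, whenever $x_n$ is a sequence in its domain with $x_n\to x$ in $\mathcal H$ and $\mathfrak s[x_n-x_m,x_n-x_m]\to0$ as $n,m\to\infty$,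 the limit $x$ lies in the domain and $\mathfrak s[x_n-x,x_n-x]\to0$. A core of a closed sectorial form $\mathfrak s$ is a subspace $V$ of its domain such that every $x$ in the domain is the limit in $\mathcal H$ of a sequence $x_n\in V$ with $\mathfrak s[x_n-x_m,x_n-x_m]\to0$ as $n,m\to\infty$. Let $\mathfrak a_k$, $k\ge0$, be the sesquilinear forms on $\mathcal D$ with $\mathfrak a(t)[x,y]=\sum_{k\ge0}t^k\mathfrak a_k[x,y]$ for all $x,y\in\mathcal D$ and all sufficiently small $|t|$; that is, $\mathfrak a_k[x,y]$ is the $k$-th Taylor coefficient of $t\mapsto\mathfrak a(t)[x,y]$ at $0$. Put $\mathfrak t=\mathfrak a_0+i\mathfrak a_1$, and define the essential numerical range $$W_e(\mathfrak t)=\{z\in\mathbb C:\ \exists\,x_n\in\mathcal D,\ \|x_n\|=1,\ x_n\rightharpoonup0,\ \mathfrak t[x_n,x_n]\to z\}.$$ For an operator $T$ with domain $\mathcal D(T)$, let $$\sigma_e(T)=\{\lambda\in\mathbb C:\ \exists\,x_n\in\mathcal D(T),\ \|x_n\|=1,\ x_n\rightharpoonup0,\ \|(T-\lambda)x_n\|\to0\},$$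 and let $\Sigma(t)=\min\sigma_e(A(t))$. **Proposition 3.2.** Assume that $\Sigma(0)=0$, i.e. $0$ is the smallest element of $\sigma_e(A(0))$. Then the minimum $\Sigma(t)$ exists for all sufficiently small $t>0$, there is a smallest real number $\omega$ with $i\omega\in W_e(\mathfrak t)$, and $$\lim_{t\to0^+}\frac{\Sigma(t)}{t}=\omega .$$ -/

import Mathlib

open Filter Topology

namespace TypeBFamily

section Forms

variable {H : Type*} [NormedAddCommGroup H] [InnerProductSpace ℂ H]

/-- Sesquilinear forms on `H` with domain `D`, linear in the first variable and conjugate-linear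
in the second one. We write `t[x, y]` for `t x y` and `t[x]` for `t x x`. -/
abbrev SesqForm (D : Submodule ℂ H) : Type _ := D →ₗ[ℂ] D →ₗ⋆[ℂ] ℂ

/-- Weak convergence to `0` of a sequence of vectors. -/
def WeaklyNull (x : ℕ → H) : Prop :=
  ∀ y : H, Tendsto (fun n => inner ℂ y (x n)) atTop (𝓝 0)

/-- The numerical range `W(t)` of a form. -/
def numRange {D : Submodule ℂ H} (t : SesqForm D) : Set ℂ :=
  {z | ∃ x : D, ‖(x : H)‖ = 1 ∧ t x x = z}

/-- The essential numerical range `W_e(t)` of a form. -/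
def essNumRange {D : Submodule ℂ H} (t : SesqForm D) : Set ℂ :=
  {z | ∃ x : ℕ → D, (∀ n, ‖(x n : H)‖ = 1) ∧ WeaklyNull (fun n => (x n : H)) ∧
    Tendsto (fun n => t (x n) (x n)) atTop (𝓝 z)}

/-- The essential spectrum `σ_e(T)` of an operator, through singular (Weyl) sequences. -/
def essSpectrum (T : H →ₗ.[ℂ] H) : Set ℂ :=
  {z | ∃ x : ℕ → T.domain, (∀ n, ‖(x n : H)‖ = 1) ∧ WeaklyNull (fun n => (x n : H)) ∧
    Tendsto (fun n => ‖T (x n) - z • (x n : H)‖) atTop (𝓝 0)}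

/-- The real points of the essential spectrum (all of it when `T` is self-adjoint). -/
def realEssSpectrum (T : H →ₗ.[ℂ] H) : Set ℝ := {s | (s : ℂ) ∈ essSpectrum T}

/-- The bottom of the essential spectrum. It is the minimum whenever
`IsLeast (realEssSpectrum T) (bottom T)`. -/
noncomputable def bottom (T : H →ₗ.[ℂ] H) : ℝ := sInf (realEssSpectrum T)

/-- The form `t` is symmetric: `t[x, y]` is the complex conjugate of `t[y, x]`. -/
def IsSymmetricForm {D : Submodule ℂ H} (t : SesqForm D) : Prop :=
  ∀ x y : D, t x y = (starRingEnd ℂ) (t y x)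

/-- The numerical range of `t` lies in a sector with vertex `v` and half-angle `θ < π / 2` about
the direction of the positive real axis. -/
def IsSectorial {D : Submodule ℂ H} (t : SesqForm D) : Prop :=
  ∃ (v : ℂ) (θ : ℝ), θ < Real.pi / 2 ∧ ∀ z ∈ numRange t, |Complex.arg (z - v)| ≤ θ

/-- `x n` is `t`-convergent to `z`: it converges to `z` in `H`, and `t[x n - x m] → 0` as
`n, m → ∞`. -/
def FormTendsto {D : Submodule ℂ H} (t : SesqForm D) (x : ℕ → D) (z : H) : Prop :=
  Tendsto (fun n => (x n : H)) atTop (𝓝 z) ∧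
    Tendsto (fun p : ℕ × ℕ => t (x p.1 - x p.2) (x p.1 - x p.2)) atTop (𝓝 0)

/-- The form `t` is closed: every `t`-convergent sequence has its limit `z` in the domain, and
`t[x n - z] → 0`. -/
def IsClosedForm {D : Submodule ℂ H} (t : SesqForm D) : Prop :=
  ∀ (x : ℕ → D) (z : H), FormTendsto t x z →
    ∃ w : D, (w : H) = z ∧ Tendsto (fun n => t (x n - w) (x n - w)) atTop (𝓝 0)

/-- `V` is a core of the closed form `t`: `V` is contained in the domain, and every vector of the
domain is the `t`-limit of a sequence in `V`. -/
def IsCore {D : Submodule ℂ H} (t : SesqForm D) (V : Submodule ℂ H) : Prop :=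
  V ≤ D ∧ ∀ w : D, ∃ x : ℕ → D, (∀ n, (x n : H) ∈ V) ∧ FormTendsto t x (w : H)

/-- The operator `T` and the (closed) form `t` correspond to each other: the domain of `T` is a
core of `t`, and `t[x, y] = ⟨T x, y⟩` on it. The inner product of Mathlib is linear in its second
argument. -/
structure Corresponds {D : Submodule ℂ H} (T : H →ₗ.[ℂ] H) (t : SesqForm D) : Prop where
  isCore : IsCore t T.domain
  apply_eq : ∀ x y : T.domain,
    t ⟨x, isCore.1 x.2⟩ ⟨y, isCore.1 y.2⟩ = inner ℂ (y : H) (T x)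

/-- A holomorphic family of type (a), parametrized by an open neighbourhood `U` of `0` in `ℂ`: closed
sectorial forms on one dense domain `D`, with `a(t)[x, y]` holomorphic in `t` for all `x, y`. -/
structure IsHolomorphicTypeA {D : Submodule ℂ H} (U : Set ℂ) (a : ℂ → SesqForm D) : Prop where
  isOpen : IsOpen U
  zero_mem : (0 : ℂ) ∈ U
  dense_domain : Dense (D : Set H)
  sectorial : ∀ t ∈ U, IsSectorial (a t)
  closed : ∀ t ∈ U, IsClosedForm (a t)
  holomorphic : ∀ x y : D, DifferentiableOn ℂ (fun t => a t x y) U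

namespace IsHolomorphicTypeA

variable {D : Submodule ℂ H} {U : Set ℂ} {a : ℂ → SesqForm D}

theorem contDiffAt (h : IsHolomorphicTypeA U a) (k : ℕ) (x y : D) :
    ContDiffAt ℂ k (fun t => a t x y) 0 :=
  ((h.holomorphic x y).analyticAt (h.isOpen.mem_nhds h.zero_mem)).contDiffAt

/-- The `k`-th coefficient form `a_k` of `a(t) = a_0 + t a_1 + t ^ 2 a_2 + ⋯`: its value at `x, y`
is the `k`-th Taylor coefficient at `0` of the holomorphic function `t ↦ a(t)[x, y]`. -/
noncomputable def coeff (h : IsHolomorphicTypeA U a) (k : ℕ) : SesqForm D :=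
  LinearMap.mk₂'ₛₗ (RingHom.id ℂ) (starRingEnd ℂ)
    (fun x y => (k.factorial : ℂ)⁻¹ * iteratedDeriv k (fun t => a t x y) 0)
    (fun x x' y => by
      have e : (fun t => a t (x + x') y) = (fun t => a t x y) + fun t => a t x' y := by
        funext t; simp
      rw [e, iteratedDeriv_add (h.contDiffAt k x y) (h.contDiffAt k x' y), mul_add])
    (fun c x y => by
      have e : (fun t => a t (c • x) y) = fun t => c * a t x y := by
        funext t; simp
      rw [e, iteratedDeriv_const_mul_field]
      simp only [RingHom.id_apply, smul_eq_mul]; ring)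
    (fun x y y' => by
      have e : (fun t => a t x (y + y')) = (fun t => a t x y) + fun t => a t x y' := by
        funext t; simp
      rw [e, iteratedDeriv_add (h.contDiffAt k x y) (h.contDiffAt k x y'), mul_add])
    (fun c x y => by
      have e : (fun t => a t x (c • y)) = fun t => (starRingEnd ℂ) c * a t x y := by
        funext t; simp
      rw [e, iteratedDeriv_const_mul_field]
      simp only [smul_eq_mul]; ring)

/-- The power series expansion that characterizes the coefficient forms. -/
theorem hasSum_coeff (h : IsHolomorphicTypeA U a) {R : ℝ} (hR : Metric.ball (0 : ℂ) R ⊆ U)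
    {t : ℂ} (ht : t ∈ Metric.ball (0 : ℂ) R) (x y : D) :
    HasSum (fun k : ℕ => t ^ k * h.coeff k x y) (a t x y) := by
  have hs := Complex.hasSum_taylorSeries_on_ball ((h.holomorphic x y).mono hR) ht
  have e : (fun k : ℕ => t ^ k * h.coeff k x y) = fun k : ℕ =>
      (k.factorial : ℂ)⁻¹ • (t - 0) ^ k • iteratedDeriv k (fun s => a s x y) 0 := by
    funext k
    simp only [coeff, LinearMap.mk₂'ₛₗ_apply, smul_eq_mul, sub_zero]
    ring
  rw [e]
  exact hs

end IsHolomorphicTypeA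

/-- `A(t)`, for the real `t` in the open neighbourhood `U` of `0`, is a self-adjoint holomorphic
family of type (B), and `a(t)` is the corresponding type (a) family of forms. -/
structure IsSelfAdjointTypeB [CompleteSpace H] {D : Submodule ℂ H} (U : Set ℂ)
    (A : ℝ → H →ₗ.[ℂ] H) (a : ℂ → SesqForm D) : Prop where
  typeA : IsHolomorphicTypeA U a
  symmetric : ∀ t : ℝ, (t : ℂ) ∈ U → IsSymmetricForm (a t)
  selfAdjoint : ∀ t : ℝ, (t : ℂ) ∈ U → IsSelfAdjoint (A t)
  corresponds : ∀ t : ℝ, (t : ℂ) ∈ U → Corresponds (A t) (a t)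

end Forms

end TypeBFamily

/-! For a closed symmetric sectorial form with nonempty essential numerical range, the smallest
point of that range is also the smallest point of the essential spectrum of the operator
(`Corresponds.exists_isLeast`): the resolvent turns a minimizing singular sequence into a Weyl
sequence. Hence Σ(t) can be computed from values of the form `a t`.

On unit vectors a(t)[x] = a₀[x] + t a₁[x] + O(t²)(a₀[x] + γ), uniformly in x
(`IsSelfAdjointTypeB.exists_expansion`). Indeed D is a Hilbert space for the inner product of a₀ +
γ, every a(t) with small real t is bounded on it by the closed graph theorem, and the uniform
boundedness principle upgrades pointwise holomorphy to one constant.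

Upper bound (`IsExpansionBound.exists_upper`): a singular sequence with a₀[xₙ] → 0 and a₁[xₙ] → ω
gives Σ(t) ≤ tω + O(t²). Lower bound (`IsExpansionBound.exists_lower`): along a singular sequence
with a(t)[xₙ] → Σ(t), a subsequence has a₀[xₙ] → α and a₁[xₙ] → β, so α + iβ lies in the essential
numerical range of a₀ + i a₁. Here α ≥ 0 because Σ(0) = 0, the upper bound forces α = O(t), and tβ -
O(t²) ≤ Σ(t). Since that range is closed and β stays bounded, β cannot remain below ω - ε while α
tends to 0 (`exists_pos_le_re`). -/

namespace TypeBFamily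

/-! ### Weakly null sequences and essential numerical ranges. -/

section General

variable {H : Type*} [NormedAddCommGroup H] [InnerProductSpace ℂ H] {D : Submodule ℂ H}

theorem IsSymmetricForm.im_eq_zero {t : SesqForm D} (h : IsSymmetricForm t) (x : D) :
    (t x x).im = 0 :=
  Complex.conj_eq_iff_im.mp (h x x).symm

theorem IsSymmetricForm.ofReal_re {t : SesqForm D} (h : IsSymmetricForm t) (x : D) :
    (((t x x).re : ℝ) : ℂ) = t x x :=
  Complex.conj_eq_iff_re.mp (h x x).symm

theorem form_smul_smul (t : SesqForm D) (c : ℝ) (x : D) :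
    t ((c : ℂ) • x) ((c : ℂ) • x) = ((c ^ 2 : ℝ) : ℂ) * t x x := by
  simp only [map_smul, LinearMap.smul_apply, map_smulₛₗ, smul_eq_mul, Complex.conj_ofReal]
  push_cast
  ring

theorem norm_normalize {x : H} (hx : x ≠ 0) : ‖((‖x‖⁻¹ : ℝ) : ℂ) • x‖ = 1 := by
  rw [norm_smul, Complex.norm_real, norm_inv, norm_norm, inv_mul_cancel₀ (norm_ne_zero_iff.mpr hx)]

/-- A lower bound of a form on unit vectors extends to all vectors. -/
theorem mul_sq_norm_le_of_unit {t : SesqForm D} {v : ℝ}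
    (h : ∀ x : D, ‖(x : H)‖ = 1 → v ≤ (t x x).re) (x : D) :
    v * ‖(x : H)‖ ^ 2 ≤ (t x x).re := by
  by_cases hx : (x : H) = 0
  · have : x = 0 := by exact_mod_cast hx
    subst this
    simp
  have hn : 0 < ‖(x : H)‖ := norm_pos_iff.mpr hx
  have h1 := h (((‖(x : H)‖⁻¹ : ℝ) : ℂ) • x) (by simpa using norm_normalize hx)
  rw [form_smul_smul, Complex.re_ofReal_mul, inv_pow, inv_mul_eq_div, le_div_iff₀ (by positivity)]
    at h1
  exact h1

theorem IsSectorial.exists_lower_bound {t : SesqForm D} (h : IsSectorial t) :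
    ∃ v : ℝ, ∀ x : D, v * ‖(x : H)‖ ^ 2 ≤ (t x x).re := by
  obtain ⟨v, θ, hθ, hv⟩ := h
  refine ⟨v.re, mul_sq_norm_le_of_unit fun x hx => ?_⟩
  have h1 := (hv _ ⟨x, hx, rfl⟩).trans hθ.le
  rw [Complex.abs_arg_le_pi_div_two_iff, Complex.sub_re] at h1
  linarith

/-- A sectorial form becomes coercive after adding a large multiple of the inner product. -/
theorem IsSectorial.exists_coercive {t : SesqForm D} (h : IsSectorial t) :
    ∃ γ : ℝ, 0 ≤ γ ∧ ∀ x : D, ‖(x : H)‖ ^ 2 ≤ (t x x).re + γ * ‖(x : H)‖ ^ 2 := by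
  obtain ⟨v, hv⟩ := h.exists_lower_bound
  refine ⟨|v| + 1, by positivity, fun x => ?_⟩
  nlinarith [hv x, neg_abs_le v, sq_nonneg ‖(x : H)‖]

theorem WeaklyNull.comp {x : ℕ → H} (h : WeaklyNull x) {φ : ℕ → ℕ} (hφ : StrictMono φ) :
    WeaklyNull (x ∘ φ) :=
  fun y => (h y).comp hφ.tendsto_atTop

theorem WeaklyNull.smul_of_bounded {x : ℕ → H} (h : WeaklyNull x) {c : ℕ → ℂ} {M : ℝ}
    (hc : ∀ n, ‖c n‖ ≤ M) : WeaklyNull (fun n => c n • x n) := by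
  intro y
  have h1 := (h y).norm.const_mul M
  rw [norm_zero, mul_zero] at h1
  refine squeeze_zero_norm (fun n => ?_) h1
  rw [inner_smul_right, norm_mul]
  exact mul_le_mul_of_nonneg_right (hc n) (norm_nonneg _)

/-- A bounded sequence that is asymptotically orthogonal to each of its members is weakly null. -/
theorem weaklyNull_of_inner_self [CompleteSpace H] {x : ℕ → H} (hb : ∀ n, ‖x n‖ ≤ 1)
    (h : ∀ m, Tendsto (fun n => inner ℂ (x m) (x n)) atTop (𝓝 0)) : WeaklyNull x := by
  -- The part of a test vector orthogonal to the closed span of the sequence contributes nothing; on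
  -- the closed span, density and the norm bound reduce the claim to the vectors `x m`.
  let K : Submodule ℂ H := (Submodule.span ℂ (Set.range x)).topologicalClosure
  have hspan : ∀ y ∈ Submodule.span ℂ (Set.range x),
      Tendsto (fun n => inner ℂ y (x n)) atTop (𝓝 0) := by
    intro y hy
    induction hy using Submodule.span_induction with
    | mem y hy => obtain ⟨m, rfl⟩ := hy; exact h m
    | zero => simp
    | add y z _ _ hy hz => simpa [inner_add_left] using hy.add hz
    | smul c y _ hy => simpa [inner_smul_left, mul_comm] using hy.const_mul ((starRingEnd ℂ) c)
  have hK : ∀ y ∈ K, Tendsto (fun n => inner ℂ y (x n)) atTop (𝓝 0) := by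
    intro y hy
    rw [Metric.tendsto_atTop]
    intro ε hε
    obtain ⟨z, hz, hyz⟩ := Metric.mem_closure_iff.mp hy (ε / 2) (half_pos hε)
    obtain ⟨N, hN⟩ := Metric.tendsto_atTop.mp (hspan z hz) (ε / 2) (half_pos hε)
    refine ⟨N, fun n hn => ?_⟩
    have h1 := hN n hn
    rw [dist_zero_right] at h1 ⊢
    have h2 : inner ℂ y (x n) = inner ℂ (y - z) (x n) + inner ℂ z (x n) := by
      rw [inner_sub_left]; ring
    have h3 : ‖inner ℂ (y - z) (x n)‖ ≤ dist y z := by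
      rw [dist_eq_norm]
      refine (norm_inner_le_norm _ _).trans ?_
      exact mul_le_of_le_one_right (norm_nonneg _) (hb n)
    rw [h2]
    linarith [norm_add_le (inner ℂ (y - z) (x n)) (inner ℂ z (x n))]
  intro y
  have : CompleteSpace K := (Submodule.isClosed_topologicalClosure _).completeSpace_coe
  obtain ⟨p, hp, q, hq, rfl⟩ := K.exists_add_mem_mem_orthogonal y
  have hxK : ∀ n, x n ∈ K := fun n =>
    Submodule.le_topologicalClosure _ (Submodule.subset_span ⟨n, rfl⟩)
  have h2 : ∀ n, inner ℂ q (x n) = 0 := fun n => (Submodule.mem_orthogonal' K q).mp hq _ (hxK n)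
  simpa [inner_add_left, h2] using hK p hp

/-- The essential numerical range through weak neighbourhoods of `0` instead of sequences. -/
theorem mem_essNumRange_iff [CompleteSpace H] {t : SesqForm D} {z : ℂ} :
    z ∈ essNumRange t ↔ ∀ (F : Finset H) (ε : ℝ), 0 < ε →
      ∃ x : D, ‖(x : H)‖ = 1 ∧ (∀ y ∈ F, ‖inner ℂ y (x : H)‖ < ε) ∧ ‖t x x - z‖ < ε := by
  constructor
  · rintro ⟨x, hx, hw, ht⟩ F ε hε
    have h1 : ∀ᶠ n in atTop, ∀ y ∈ F, ‖inner ℂ y (x n : H)‖ < ε := by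
      rw [Filter.eventually_all_finset]
      intro y _
      simpa using (hw y).norm.eventually (gt_mem_nhds (by simpa using hε))
    have h2 : ∀ᶠ n in atTop, ‖t (x n) (x n) - z‖ < ε := by
      simpa [dist_eq_norm] using ht.eventually (Metric.ball_mem_nhds z hε)
    obtain ⟨n, h1, h2⟩ := (h1.and h2).exists
    exact ⟨x n, hx n, h1, h2⟩
  · intro h
    classical
    obtain ⟨f, hf, hr⟩ := exists_seq_of_forall_finset_exists
      -- Each vector carries a counter that sets its tolerance. The counter increases strictly, so
      -- the tolerances tend to 0, and each new vector is nearly orthogonal to all earlier ones.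
      (fun p : D × ℕ => ‖(p.1 : H)‖ = 1 ∧ ‖t p.1 p.1 - z‖ < 1 / ((p.2 : ℝ) + 1))
      (fun p q => p.2 < q.2 ∧ ‖inner ℂ (p.1 : H) (q.1 : H)‖ < 1 / ((q.2 : ℝ) + 1))
      (fun s _ => by
        obtain ⟨x, hx, hF, hz⟩ := h (s.image fun p => (p.1 : H))
          (1 / (((s.sup fun p => p.2) + 1 : ℕ) + 1 : ℝ)) (by positivity)
        refine ⟨(x, (s.sup fun p => p.2) + 1), ⟨hx, hz⟩, fun p hp => ⟨?_, ?_⟩⟩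
        · exact Nat.lt_succ_of_le (Finset.le_sup (f := fun p : D × ℕ => p.2) hp)
        · exact hF _ (Finset.mem_image_of_mem _ hp))
    have hmono : StrictMono fun n => (f n).2 := fun m n hmn => (hr m n hmn).1
    have h0 : Tendsto (fun n => 1 / (((f n).2 : ℝ) + 1)) atTop (𝓝 0) :=
      tendsto_one_div_add_atTop_nhds_zero_nat.comp hmono.tendsto_atTop
    refine ⟨fun n => (f n).1, fun n => (hf n).1, ?_, ?_⟩
    · refine weaklyNull_of_inner_self (fun n => (hf n).1.le) fun m => ?_
      refine squeeze_zero_norm' ?_ h0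
      filter_upwards [eventually_gt_atTop m] with n hn
      exact (hr m n hn).2.le
    · rw [tendsto_iff_norm_sub_tendsto_zero]
      exact squeeze_zero (fun _ => norm_nonneg _) (fun n => (hf n).2.le) h0

/-- The criterion by finite sets of test vectors makes this an ε/2 argument, although H may be
nonseparable and a diagonal choice of weakly null sequences is not directly available. -/
theorem isClosed_essNumRange [CompleteSpace H] (t : SesqForm D) : IsClosed (essNumRange t) := by
  refine isClosed_of_closure_subset fun z hz => ?_
  rw [mem_essNumRange_iff]
  intro F ε hε
  obtain ⟨w, hw, hzw⟩ := Metric.mem_closure_iff.mp hz (ε / 2) (half_pos hε)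
  obtain ⟨x, hx, hF, ht⟩ := mem_essNumRange_iff.mp hw F (ε / 2) (half_pos hε)
  refine ⟨x, hx, fun y hy => (hF y hy).trans (half_lt_self hε), ?_⟩
  rw [dist_comm, dist_eq_norm] at hzw
  calc ‖t x x - z‖ = ‖(t x x - w) + (w - z)‖ := by congr 1; ring
    _ ≤ ‖t x x - w‖ + ‖w - z‖ := norm_add_le _ _
    _ < ε := by linarith

/-- The real points of the essential numerical range (all of it for a symmetric form). -/
def realEssNumRange (t : SesqForm D) : Set ℝ := {s | (s : ℂ) ∈ essNumRange t}

theorem isClosed_realEssNumRange [CompleteSpace H] (t : SesqForm D) :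
    IsClosed (realEssNumRange t) :=
  (isClosed_essNumRange t).preimage Complex.continuous_ofReal

theorem IsSymmetricForm.im_eq_zero_of_mem {t : SesqForm D} (h : IsSymmetricForm t) {z : ℂ}
    (hz : z ∈ essNumRange t) : z.im = 0 := by
  obtain ⟨x, -, -, ht⟩ := hz
  have h1 := (Complex.continuous_im.tendsto z).comp ht
  refine tendsto_nhds_unique h1 ?_
  simp [Function.comp_def, h.im_eq_zero]

/-- Along a singular sequence on which the form is bounded, a subsequence of the values converges
to a point of the essential numerical range. -/
theorem exists_subseq_mem_essNumRange {t : SesqForm D} {x : ℕ → D} (hx : ∀ n, ‖(x n : H)‖ = 1)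
    (hw : WeaklyNull fun n => (x n : H)) {M : ℝ} (hM : ∀ n, ‖t (x n) (x n)‖ ≤ M) :
    ∃ z ∈ essNumRange t, ∃ φ : ℕ → ℕ, StrictMono φ ∧
      Tendsto (fun n => t (x (φ n)) (x (φ n))) atTop (𝓝 z) := by
  obtain ⟨z, -, φ, hφ, hz⟩ := tendsto_subseq_of_bounded (Metric.isBounded_closedBall (x := 0) (r := M))
    (x := fun n => t (x n) (x n)) (fun n => by simpa using hM n)
  exact ⟨z, ⟨x ∘ φ, fun n => hx _, hw.comp hφ, hz⟩, φ, hφ, hz⟩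

theorem lower_bound_realEssNumRange {t : SesqForm D} {v : ℝ}
    (hv : ∀ x : D, v * ‖(x : H)‖ ^ 2 ≤ (t x x).re) {s : ℝ} (hs : s ∈ realEssNumRange t) :
    v ≤ s := by
  obtain ⟨x, hx, -, ht⟩ := hs
  have h1 := (Complex.continuous_re.tendsto _).comp ht
  rw [Complex.ofReal_re] at h1
  refine ge_of_tendsto' h1 fun n => ?_
  simpa [hx n] using hv (x n)

/-- A lower bound of the essential numerical range is asymptotically a lower bound of the form
along every bounded weakly null sequence. -/
theorem eventually_le_of_lowerBound {t : SesqForm D} (hsym : IsSymmetricForm t) {v l : ℝ}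
    (hv : ∀ x : D, v * ‖(x : H)‖ ^ 2 ≤ (t x x).re) (hl : l ∈ lowerBounds (realEssNumRange t))
    {z : ℕ → D} {M : ℝ} (hM : ∀ n, ‖(z n : H)‖ ≤ M) (hw : WeaklyNull fun n => (z n : H))
    {ε : ℝ} (hε : 0 < ε) :
    ∀ᶠ n in atTop, l * ‖(z n : H)‖ ^ 2 - ε ≤ (t (z n) (z n)).re := by
  by_contra hcon
  obtain ⟨φ, hφ, hlt⟩ := extraction_of_frequently_atTop (not_eventually.mp hcon)
  simp only [not_le] at hlt
  have hM0 : 0 ≤ M := (norm_nonneg _).trans (hM 0)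
  set c : ℝ := |l - v| + 1 with hc
  have hc0 : 0 < c := by positivity
  -- The lower bound `v` keeps the norms of the violating vectors away from 0, so they stay weakly
  -- null after normalization.
  have hlow : ∀ n, ε ≤ c * ‖(z (φ n) : H)‖ ^ 2 := fun n => by
    nlinarith [hlt n, hv (z (φ n)), le_abs_self (l - v), sq_nonneg ‖(z (φ n) : H)‖]
  have hne : ∀ n, (z (φ n) : H) ≠ 0 := fun n h0 => by
    have := hlow n
    rw [h0, norm_zero] at this
    simp at this
    linarith
  have hpos : ∀ n, 0 < ‖(z (φ n) : H)‖ := fun n => norm_pos_iff.mpr (hne n)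
  let u : ℕ → D := fun n => ((‖(z (φ n) : H)‖⁻¹ : ℝ) : ℂ) • z (φ n)
  have hu1 : ∀ n, ‖(u n : H)‖ = 1 := fun n => by simpa [u] using norm_normalize (hne n)
  have hδ : ∀ n, √(ε / c) ≤ ‖(z (φ n) : H)‖ := fun n => by
    apply Real.sqrt_le_iff.mpr
    refine ⟨norm_nonneg _, ?_⟩
    rw [div_le_iff₀ hc0]
    linarith [hlow n]
  have hδ0 : 0 < √(ε / c) := Real.sqrt_pos.mpr (by positivity)
  have huw : WeaklyNull fun n => (u n : H) := by
    refine (hw.comp hφ).smul_of_bounded (M := (√(ε / c))⁻¹) fun n => ?_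
    rw [Complex.norm_real, norm_inv, norm_norm]
    exact inv_anti₀ hδ0 (hδ n)
  -- The part of the gap `ε` that survives division by the squared norm, which is at most `M ^ 2 +
  -- 1`.
  set η : ℝ := ε / (M ^ 2 + 1) with hη
  have hη0 : 0 < η := by positivity
  have hle : ∀ n, (t (u n) (u n)).re ≤ l - η := fun n => by
    have e1 : (t (u n) (u n)).re = (t (z (φ n)) (z (φ n))).re / ‖(z (φ n) : H)‖ ^ 2 := by
      simp only [u]
      rw [form_smul_smul, Complex.re_ofReal_mul, inv_pow, inv_mul_eq_div]
    rw [e1, div_le_iff₀ (pow_pos (hpos n) 2)]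
    have h2 : ‖(z (φ n) : H)‖ ^ 2 ≤ M ^ 2 + 1 := by
      nlinarith [hM (φ n), hpos n]
    have h3 : η * ‖(z (φ n) : H)‖ ^ 2 ≤ ε := by
      calc η * ‖(z (φ n) : H)‖ ^ 2 ≤ η * (M ^ 2 + 1) := by gcongr
        _ = ε := by rw [hη]; field_simp
    linarith [hlt n]
  have hbd : ∀ n, ‖t (u n) (u n)‖ ≤ |v| + |l| := fun n => by
    have h1 := hv (u n)
    rw [hu1 n] at h1
    rw [← hsym.ofReal_re, Complex.norm_real, Real.norm_eq_abs, abs_le]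
    constructor
    · linarith [neg_abs_le v, abs_nonneg l]
    · linarith [hle n, le_abs_self l, abs_nonneg v]
  obtain ⟨w, hwmem, ψ, -, hψ⟩ := exists_subseq_mem_essNumRange hu1 huw hbd
  have hwre : ((w.re : ℝ) : ℂ) = w :=
    Complex.ext (by simp) (by simp [hsym.im_eq_zero_of_mem hwmem])
  have h1 : l ≤ w.re := hl (by change ((w.re : ℝ) : ℂ) ∈ essNumRange t; rwa [hwre])
  have h2 : w.re ≤ l - η :=
    le_of_tendsto' ((Complex.continuous_re.tendsto _).comp hψ) fun n => hle _
  linarith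

end General

end TypeBFamily

namespace TypeBFamily

/-! ### The Hilbert space of a closed form, and boundedness of other forms on it. -/

section FormSpace

universe u

variable {H : Type u} [NormedAddCommGroup H] [InnerProductSpace ℂ H] {D : Submodule ℂ H}

/-- The domain of a form, to carry the inner product `⟨x, y⟩ = t[y, x] + γ ⟨x, y⟩`. -/
def FormSpace (D : Submodule ℂ H) : Type u := D

instance : AddCommGroup (FormSpace D) := inferInstanceAs (AddCommGroup D)

instance : Module ℂ (FormSpace D) := inferInstanceAs (Module ℂ D)

/-- The identification of the form space with the domain. -/
def FormSpace.equiv (D : Submodule ℂ H) : FormSpace D ≃ₗ[ℂ] D := LinearEquiv.refl ℂ D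

/-- The inner product of the form space. -/
@[reducible]
noncomputable def formCore {t : SesqForm D} (hs : IsSymmetricForm t) {γ : ℝ}
    (hγ : ∀ x : D, ‖(x : H)‖ ^ 2 ≤ (t x x).re + γ * ‖(x : H)‖ ^ 2) :
    InnerProductSpace.Core ℂ (FormSpace D) where
  inner x y := t (FormSpace.equiv D y) (FormSpace.equiv D x) +
    γ * inner ℂ (FormSpace.equiv D x : H) (FormSpace.equiv D y : H)
  conj_inner_symm x y := by
    rw [map_add, map_mul, Complex.conj_ofReal, ← hs, inner_conj_symm]
  re_inner_nonneg x := by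
    have h1 := hγ (FormSpace.equiv D x)
    have h2 : (t (FormSpace.equiv D x) (FormSpace.equiv D x) +
        γ * inner ℂ (FormSpace.equiv D x : H) (FormSpace.equiv D x : H)).re =
        (t (FormSpace.equiv D x) (FormSpace.equiv D x)).re +
          γ * ‖(FormSpace.equiv D x : H)‖ ^ 2 := by
      rw [Complex.add_re, Complex.re_ofReal_mul, inner_self_eq_norm_sq_to_K]
      norm_cast
    change 0 ≤ (t (FormSpace.equiv D x) (FormSpace.equiv D x) +
        γ * inner ℂ (FormSpace.equiv D x : H) (FormSpace.equiv D x : H)).re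
    rw [h2]
    exact (sq_nonneg _).trans h1
  add_left x y z := by
    simp only [map_add, Submodule.coe_add, inner_add_left]
    ring
  smul_left x y c := by
    simp only [map_smul, map_smulₛₗ, Submodule.coe_smul, inner_smul_left, smul_eq_mul]
    ring
  definite x hx := by
    have h1 := hγ (FormSpace.equiv D x)
    have h2 := congrArg Complex.re hx
    rw [Complex.add_re, Complex.re_ofReal_mul, inner_self_eq_norm_sq_to_K, Complex.zero_re] at h2
    norm_cast at h2
    have h3 : ‖(FormSpace.equiv D x : H)‖ ^ 2 ≤ 0 := h1.trans_eq h2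
    have h4 : (FormSpace.equiv D x : H) = 0 := by
      rw [← norm_eq_zero]
      nlinarith [norm_nonneg (FormSpace.equiv D x : H)]
    exact (FormSpace.equiv D).map_eq_zero_iff.mp (by exact_mod_cast h4)

/-- `e` identifies the Hilbert space `E` with the domain `D`, its inner product being that of the
form `t + γ`. -/
structure IsFormSpace {E : Type*} [NormedAddCommGroup E] [InnerProductSpace ℂ E]
    (t : SesqForm D) (γ : ℝ) (e : E ≃ₗ[ℂ] D) : Prop where
  inner_eq : ∀ x y : E, inner ℂ x y = t (e y) (e x) + γ * inner ℂ (e x : H) (e y : H)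
  norm_le : ∀ x : E, ‖(e x : H)‖ ≤ ‖x‖

theorem IsFormSpace.norm_sq {E : Type*} [NormedAddCommGroup E] [InnerProductSpace ℂ E]
    {t : SesqForm D} {γ : ℝ} {e : E ≃ₗ[ℂ] D} (h : IsFormSpace t γ e) (x : E) :
    ‖x‖ ^ 2 = (t (e x) (e x)).re + γ * ‖(e x : H)‖ ^ 2 := by
  have h1 := congrArg Complex.re (h.inner_eq x x)
  rw [Complex.add_re, Complex.re_ofReal_mul, inner_self_eq_norm_sq_to_K,
    inner_self_eq_norm_sq_to_K] at h1
  norm_cast at h1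

/-- Completeness is closedness of the form: a Cauchy sequence for the form norm converges in H and
is `t`-convergent. A separate type `E` keeps this norm apart from the one that D inherits from H. -/
theorem exists_isFormSpace [CompleteSpace H] {t : SesqForm D} (hs : IsSymmetricForm t)
    (hc : IsClosedForm t) {γ : ℝ}
    (hγ : ∀ x : D, ‖(x : H)‖ ^ 2 ≤ (t x x).re + γ * ‖(x : H)‖ ^ 2) :
    ∃ (E : Type u) (_ : NormedAddCommGroup E) (_ : InnerProductSpace ℂ E) (e : E ≃ₗ[ℂ] D),
      CompleteSpace E ∧ IsFormSpace t γ e := by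
  let c := formCore hs hγ
  let _ : NormedAddCommGroup (FormSpace D) := c.toNormedAddCommGroup
  let _ : InnerProductSpace ℂ (FormSpace D) := InnerProductSpace.ofCore c.toCore
  let e := FormSpace.equiv D
  have hin : ∀ x y : FormSpace D,
      inner ℂ x y = t (e y) (e x) + γ * inner ℂ (e x : H) (e y : H) := fun x y => rfl
  have hsq : ∀ x : FormSpace D, ‖x‖ ^ 2 = (t (e x) (e x)).re + γ * ‖(e x : H)‖ ^ 2 := fun x => by
    have h1 := congrArg Complex.re (hin x x)
    rw [Complex.add_re, Complex.re_ofReal_mul, inner_self_eq_norm_sq_to_K,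
      inner_self_eq_norm_sq_to_K] at h1
    norm_cast at h1
  have hle : ∀ x : FormSpace D, ‖(e x : H)‖ ≤ ‖x‖ := fun x =>
    le_of_sq_le_sq (by rw [hsq]; exact hγ _) (norm_nonneg _)
  refine ⟨FormSpace D, inferInstance, inferInstance, e, ?_, ⟨hin, hle⟩⟩
  refine Metric.complete_of_cauchySeq_tendsto fun x hx => ?_
  have hxH : CauchySeq fun n => (e (x n) : H) := by
    rw [Metric.cauchySeq_iff] at hx ⊢
    intro ε hε
    obtain ⟨N, hN⟩ := hx ε hε
    refine ⟨N, fun m hm n hn => lt_of_le_of_lt ?_ (hN m hm n hn)⟩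
    rw [dist_eq_norm, dist_eq_norm]
    simpa using hle (x m - x n)
  obtain ⟨z, hz⟩ := cauchySeq_tendsto_of_complete hxH
  have hn2 : Tendsto (fun p : ℕ × ℕ => ‖x p.1 - x p.2‖) atTop (𝓝 0) := by
    simpa [dist_eq_norm] using cauchySeq_iff_tendsto_dist_atTop_0.mp hx
  have hn1 : Tendsto (fun p : ℕ × ℕ => ‖(e (x p.1) : H) - e (x p.2)‖) atTop (𝓝 0) :=
    squeeze_zero (fun _ => norm_nonneg _) (fun p => by simpa using hle (x p.1 - x p.2)) hn2
  have hform : Tendsto (fun p : ℕ × ℕ => t (e (x p.1) - e (x p.2)) (e (x p.1) - e (x p.2)))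
      atTop (𝓝 0) := by
    have h1 := (hn2.pow 2).sub ((hn1.pow 2).const_mul γ)
    have h2 := (Complex.continuous_ofReal.tendsto _).comp h1
    norm_num at h2
    refine h2.congr fun p => ?_
    rw [← hs.ofReal_re]
    simp only [Function.comp_apply]
    have h3 := hsq (x p.1 - x p.2)
    rw [map_sub] at h3
    rw [h3]
    simp
  obtain ⟨w, hw, hlim⟩ := hc (fun n => e (x n)) z ⟨hz, hform⟩
  refine ⟨e.symm w, ?_⟩
  rw [tendsto_iff_norm_sub_tendsto_zero]
  have h1 : Tendsto (fun n => ‖(e (x n) : H) - w‖) atTop (𝓝 0) := by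
    rw [hw]
    exact tendsto_iff_norm_sub_tendsto_zero.mp hz
  have h2 := ((Complex.continuous_re.tendsto _).comp hlim).add ((h1.pow 2).const_mul γ)
  have h3 : Tendsto (fun n => ‖x n - e.symm w‖ ^ 2) atTop (𝓝 0) := by
    norm_num at h2
    refine h2.congr fun n => ?_
    rw [hsq]
    simp
  simpa using h3.sqrt

variable {E : Type*} [NormedAddCommGroup E] [InnerProductSpace ℂ E]

/-- Two complete form norms on one domain are comparable, by the closed graph theorem. -/
theorem IsFormSpace.exists_norm_le [CompleteSpace E] {E' : Type*} [NormedAddCommGroup E']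
    [InnerProductSpace ℂ E'] [CompleteSpace E'] {t s : SesqForm D} {γ γ' : ℝ} {e : E ≃ₗ[ℂ] D}
    {e' : E' ≃ₗ[ℂ] D} (h : IsFormSpace t γ e) (h' : IsFormSpace s γ' e') :
    ∃ M, 0 ≤ M ∧ ∀ x : E, ‖e'.symm (e x)‖ ≤ M * ‖x‖ := by
  let f : E →ₗ[ℂ] E' := (e.trans e'.symm).toLinearMap
  have hf : Continuous f := by
    -- Both form norms dominate the norm of H, so the two limits coincide in H.
    refine f.continuous_of_seq_closed_graph fun x z y hx hy => ?_
    have h1 : Tendsto (fun n => (e (x n) : H)) atTop (𝓝 (e z : H)) := by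
      rw [tendsto_iff_norm_sub_tendsto_zero] at hx ⊢
      exact squeeze_zero (fun _ => norm_nonneg _) (fun n => by simpa using h.norm_le (x n - z)) hx
    have h2 : Tendsto (fun n => (e (x n) : H)) atTop (𝓝 (e' y : H)) := by
      rw [tendsto_iff_norm_sub_tendsto_zero] at hy ⊢
      exact squeeze_zero (fun _ => norm_nonneg _)
        (fun n => by simpa [f] using h'.norm_le (f (x n) - y)) hy
    have h3 : e z = e' y := Subtype.ext (tendsto_nhds_unique h1 h2)
    simp [f, h3]
  let g : E →L[ℂ] E' := ⟨f, hf⟩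
  exact ⟨‖g‖, norm_nonneg _, fun x => g.le_opNorm x⟩

theorem IsFormSpace.norm_apply_le {t : SesqForm D} {γ : ℝ} {e : E ≃ₗ[ℂ] D}
    (h : IsFormSpace t γ e) (x y : E) : ‖t (e x) (e y)‖ ≤ (1 + |γ|) * ‖x‖ * ‖y‖ := by
  have h1 : t (e x) (e y) = inner ℂ y x - γ * inner ℂ (e y : H) (e x : H) := by
    rw [h.inner_eq]; ring
  have h2 : ‖inner ℂ (e y : H) (e x : H)‖ ≤ ‖y‖ * ‖x‖ :=
    (norm_inner_le_norm _ _).trans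
      (mul_le_mul (h.norm_le y) (h.norm_le x) (norm_nonneg _) (norm_nonneg _))
  calc ‖t (e x) (e y)‖ ≤ ‖inner ℂ y x‖ + ‖(γ : ℂ) * inner ℂ (e y : H) (e x : H)‖ := by
        rw [h1]; exact norm_sub_le _ _
    _ ≤ ‖y‖ * ‖x‖ + |γ| * (‖y‖ * ‖x‖) := by
        rw [norm_mul, Complex.norm_real, Real.norm_eq_abs]
        gcongr
        exact norm_inner_le_norm _ _
    _ = (1 + |γ|) * ‖x‖ * ‖y‖ := by ring

/-- A closed symmetric sectorial form is bounded in the norm of any other such form on the same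
domain. -/
theorem IsFormSpace.exists_bound [CompleteSpace H] [CompleteSpace E] {t : SesqForm D} {γ : ℝ}
    {e : E ≃ₗ[ℂ] D} (h : IsFormSpace t γ e) {s : SesqForm D} (hs : IsSymmetricForm s)
    (hsec : IsSectorial s) (hc : IsClosedForm s) :
    ∃ M, ∀ x y : E, ‖s (e x) (e y)‖ ≤ M * ‖x‖ * ‖y‖ := by
  obtain ⟨γ', -, hγ'⟩ := hsec.exists_coercive
  obtain ⟨E', _, _, e', _, h'⟩ := exists_isFormSpace hs hc hγ'
  obtain ⟨M, hM0, hM⟩ := h.exists_norm_le h'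
  refine ⟨(1 + |γ'|) * M * M, fun x y => ?_⟩
  calc ‖s (e x) (e y)‖ = ‖s (e' (e'.symm (e x))) (e' (e'.symm (e y)))‖ := by simp
    _ ≤ (1 + |γ'|) * ‖e'.symm (e x)‖ * ‖e'.symm (e y)‖ := h'.norm_apply_le _ _
    _ ≤ (1 + |γ'|) * (M * ‖x‖) * (M * ‖y‖) := by
        gcongr
        · exact hM x
        · exact hM y
    _ = (1 + |γ'|) * M * M * ‖x‖ * ‖y‖ := by ring

/-- The uniform boundedness principle for sesquilinear forms. -/
theorem exists_uniform_bound [CompleteSpace E] {ι : Type*} (B : ι → E →ₗ[ℂ] E →ₗ⋆[ℂ] ℂ)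
    (hB : ∀ i, ∃ M, ∀ x y, ‖B i x y‖ ≤ M * ‖x‖ * ‖y‖) (hp : ∀ x y, ∃ C, ∀ i, ‖B i x y‖ ≤ C) :
    ∃ C, ∀ i x y, ‖B i x y‖ ≤ C * ‖x‖ * ‖y‖ := by
  choose M hM using hB
  let T : ι → E →L[ℂ] E →L⋆[ℂ] ℂ := fun i => (B i).mkContinuous₂ (M i) (hM i)
  -- Banach–Steinhaus is used twice: in the second variable for fixed `x`, then in the first.
  have h1 : ∀ x, ∃ C, ∀ i, ‖T i x‖ ≤ C := fun x =>
    banach_steinhaus (g := fun i => T i x) (hp x)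
  obtain ⟨C, hC⟩ := banach_steinhaus (g := T) h1
  exact ⟨C, fun i x y => ((T i).le_opNorm₂ x y).trans (by gcongr; exact hC i)⟩

end FormSpace

end TypeBFamily

namespace TypeBFamily

/-! ### The bottom of the essential spectrum through the form. -/

section Operator

universe u

variable {H : Type u} [NormedAddCommGroup H] [InnerProductSpace ℂ H]
  {D : Submodule ℂ H} {t : SesqForm D} {γ : ℝ} {A : H →ₗ.[ℂ] H}

theorem Corresponds.inner_apply (hcor : Corresponds A t) (hs : IsSymmetricForm t)
    (p v : A.domain) : inner ℂ (A p) (v : H) = inner ℂ (p : H) (A v) := by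
  rw [← inner_conj_symm, ← hcor.apply_eq, ← hcor.apply_eq, ← hs]

theorem Corresponds.realEssSpectrum_subset (hcor : Corresponds A t) :
    realEssSpectrum A ⊆ realEssNumRange t := by
  rintro s ⟨x, hx, hw, hlim⟩
  refine ⟨fun n => ⟨x n, hcor.isCore.1 (x n).2⟩, hx, hw, ?_⟩
  rw [tendsto_iff_norm_sub_tendsto_zero]
  refine squeeze_zero (fun _ => norm_nonneg _) (fun n => ?_) hlim
  rw [hcor.apply_eq]
  have h1 : inner ℂ (x n : H) (A (x n)) - (s : ℂ) =
      inner ℂ (x n : H) (A (x n) - (s : ℂ) • (x n : H)) := by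
    rw [inner_sub_right, inner_smul_right, inner_self_eq_norm_sq_to_K, hx n]
    simp
  rw [h1]
  refine (norm_inner_le_norm _ _).trans_eq ?_
  rw [hx n, one_mul]

variable [CompleteSpace H]

/-- The representation of the form by the operator extends from the core to the form domain. -/
theorem Corresponds.apply_eq_inner (hcor : Corresponds A t) (hs : IsSymmetricForm t)
    (hc : IsClosedForm t) (hγ : ∀ x : D, ‖(x : H)‖ ^ 2 ≤ (t x x).re + γ * ‖(x : H)‖ ^ 2)
    (y : A.domain) (w : D) : t ⟨y, hcor.isCore.1 y.2⟩ w = inner ℂ (w : H) (A y) := by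
  obtain ⟨E, _, _, e, _, he⟩ := exists_isFormSpace hs hc hγ
  obtain ⟨x, hxA, hx⟩ := hcor.isCore.2 w
  obtain ⟨w', hw', hlim⟩ := hc x w hx
  obtain rfl : w' = w := Subtype.ext hw'
  have h1 : Tendsto (fun n => ‖(x n : H) - w'‖) atTop (𝓝 0) :=
    tendsto_iff_norm_sub_tendsto_zero.mp hx.1
  -- Closedness gives convergence in the form norm, for which `t yD` is continuous.
  have h2 : Tendsto (fun n => e.symm (x n)) atTop (𝓝 (e.symm w')) := by
    rw [tendsto_iff_norm_sub_tendsto_zero]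
    have h2 := ((Complex.continuous_re.tendsto _).comp hlim).add ((h1.pow 2).const_mul γ)
    have h3 : Tendsto (fun n => ‖e.symm (x n) - e.symm w'‖ ^ 2) atTop (𝓝 0) := by
      norm_num at h2
      refine h2.congr fun n => ?_
      rw [he.norm_sq]
      simp
    simpa using h3.sqrt
  set yD : D := ⟨y, hcor.isCore.1 y.2⟩ with hyD
  have h4 : ∀ v : D, t yD v = inner ℂ (e.symm v) (e.symm yD) - γ * inner ℂ (v : H) (yD : H) := by
    intro v
    rw [he.inner_eq]
    simp
  have h5 : Tendsto (fun n => t yD (x n)) atTop (𝓝 (t yD w')) := by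
    simp only [h4]
    exact (h2.inner tendsto_const_nhds).sub ((hx.1.inner tendsto_const_nhds).const_mul _)
  refine tendsto_nhds_unique h5 ?_
  have h6 : ∀ n, t yD (x n) = inner ℂ (x n : H) (A y) := fun n =>
    hcor.apply_eq y ⟨x n, hxA n⟩
  simp only [h6]
  exact hx.1.inner tendsto_const_nhds

/-- `A + γ` is onto when `t + γ` is coercive. -/
theorem Corresponds.exists_add_smul_eq (hcor : Corresponds A t) (hA : IsSelfAdjoint A)
    (hs : IsSymmetricForm t) (hc : IsClosedForm t)
    (hγ : ∀ x : D, ‖(x : H)‖ ^ 2 ≤ (t x x).re + γ * ‖(x : H)‖ ^ 2) (u : H) :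
    ∃ v : A.domain, A v + (γ : ℂ) • (v : H) = u := by
  obtain ⟨E, _, _, e, _, he⟩ := exists_isFormSpace hs hc hγ
  -- The Riesz representative of this functional on the form space is a weak solution of `(A + γ) v
  -- = u`.
  let f : StrongDual ℂ E := LinearMap.mkContinuous
    ((innerₛₗ ℂ u).comp (D.subtype.comp e.toLinearMap)) ‖u‖ (fun x => by
      refine (norm_inner_le_norm (𝕜 := ℂ) u (e x : H)).trans ?_
      gcongr
      exact he.norm_le x)
  set v : E := (InnerProductSpace.toDual ℂ E).symm f with hv
  have h1 : ∀ x : E, inner ℂ v x = inner ℂ u (e x : H) := fun x => by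
    rw [hv, InnerProductSpace.toDual_symm_apply]
    rfl
  have h2 : ∀ y : A.domain, inner ℂ (u - (γ : ℂ) • (e v : H)) (y : H) = inner ℂ (e v : H) (A y) := by
    intro y
    have h3 := h1 (e.symm ⟨y, hcor.isCore.1 y.2⟩)
    rw [he.inner_eq, LinearEquiv.apply_symm_apply, hcor.apply_eq_inner hs hc hγ] at h3
    rw [inner_sub_left, inner_smul_left, Complex.conj_ofReal, ← h3]
    ring
  -- By `h2` the weak solution lies in the domain of the adjoint, which is `A` itself.
  have hmem := LinearPMap.mem_adjoint_domain_of_exists (T := A) (e v : H) ⟨_, h2⟩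
  have h4 := LinearPMap.adjoint_apply_eq hA.dense_domain ⟨_, hmem⟩ h2
  have h5 : ((e v : H), u - (γ : ℂ) • (e v : H)) ∈ A.adjoint.graph :=
    LinearPMap.mem_graph_iff _ |>.mpr ⟨⟨_, hmem⟩, rfl, h4⟩
  rw [LinearPMap.isSelfAdjoint_def.mp hA, LinearPMap.mem_graph_iff] at h5
  obtain ⟨p, hp1, hp2⟩ := h5
  simp only at hp1 hp2
  exact ⟨p, by rw [hp2, hp1]; abel⟩

/-- The smallest point of the essential numerical range of the form lies in the essential spectrum
of the operator. -/
theorem Corresponds.mem_realEssSpectrum (hcor : Corresponds A t) (hA : IsSelfAdjoint A)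
    (hs : IsSymmetricForm t) (hc : IsClosedForm t)
    (hγ : ∀ x : D, ‖(x : H)‖ ^ 2 ≤ (t x x).re + γ * ‖(x : H)‖ ^ 2) {l : ℝ}
    (hl : IsLeast (realEssNumRange t) l) : l ∈ realEssSpectrum A := by
  have hlow : ∀ x : D, (1 - γ) * ‖(x : H)‖ ^ 2 ≤ (t x x).re := fun x => by linarith [hγ x]
  have hκ : 0 < l + γ := by linarith [lower_bound_realEssNumRange hlow hl.1]
  set κ : ℝ := l + γ with hκdef
  obtain ⟨x, hx, hxw, hxt⟩ := hl.1
  choose R hR using hcor.exists_add_smul_eq hA hs hc hγ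
  let v : ℕ → A.domain := fun n => R (x n)
  have hv : ∀ n, A (v n) + (γ : ℂ) • (v n : H) = x n := fun n => hR _
  -- `z n` is `(l + γ)(A + γ)⁻¹ x n`, which would equal `x n` for an eigenvector at `l`. Its
  -- residual `(A - l) z n` is `κ • w n`, so it suffices that `w n → 0`.
  let z : ℕ → A.domain := fun n => (κ : ℂ) • v n
  let zD : ℕ → D := fun n => ⟨z n, hcor.isCore.1 (z n).2⟩
  let w : ℕ → D := fun n => x n - zD n
  have hform : ∀ n (y : D), t (zD n) y + γ * inner ℂ (y : H) (zD n : H) =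
      κ * inner ℂ (y : H) (x n : H) := fun n y => by
    have h1 : t (zD n) y = inner ℂ (y : H) (A (z n)) :=
      hcor.apply_eq_inner hs hc hγ (z n) y
    have h2 : (zD n : H) = (κ : ℂ) • (v n : H) := rfl
    rw [h1, h2, ← hv n, LinearPMap.map_smul, inner_smul_right, inner_smul_right, inner_add_right,
      inner_smul_right]
    ring
  have hvn : ∀ n, ‖(v n : H)‖ ≤ 1 := fun n => by
    have h1 := hγ ⟨v n, hcor.isCore.1 (v n).2⟩
    have h2 : t ⟨v n, hcor.isCore.1 (v n).2⟩ ⟨v n, hcor.isCore.1 (v n).2⟩ +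
        γ * ((‖(v n : H)‖ ^ 2 : ℝ) : ℂ) = inner ℂ (v n : H) (x n : H) := by
      rw [hcor.apply_eq_inner hs hc hγ, ← hv n, inner_add_right, inner_smul_right,
        inner_self_eq_norm_sq_to_K]
      push_cast
      rfl
    have h3 := congrArg Complex.re h2
    rw [Complex.add_re, Complex.re_ofReal_mul, Complex.ofReal_re] at h3
    have h4 : (inner ℂ (v n : H) (x n : H)).re ≤ ‖(v n : H)‖ := by
      simpa [hx n] using re_inner_le_norm (𝕜 := ℂ) (v n : H) (x n : H)
    simp only at h1
    nlinarith [norm_nonneg (v n : H)]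
  have hvw : WeaklyNull fun n => (v n : H) := fun y => by
    have h1 : ∀ n, inner ℂ y (v n : H) = inner ℂ (R y : H) (x n : H) := fun n => by
      conv_lhs => rw [← hR y]
      rw [← hv n, inner_add_left, inner_add_right, hcor.inner_apply hs, inner_smul_left,
        inner_smul_right, Complex.conj_ofReal]
    simp only [h1]
    exact hxw _
  have hzw : WeaklyNull fun n => (zD n : H) :=
    hvw.smul_of_bounded (c := fun _ => (κ : ℂ)) (fun _ => le_rfl)
  have hzM : ∀ n, ‖(zD n : H)‖ ≤ κ := fun n => by
    change ‖(κ : ℂ) • (v n : H)‖ ≤ κ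
    rw [norm_smul, Complex.norm_real, Real.norm_eq_abs, abs_of_pos hκ]
    exact mul_le_of_le_one_right hκ.le (hvn n)
  -- With q = t - l‖·‖², `hform` makes the cross term in q(z + w) equal to 2κ‖w‖², while coercivity
  -- gives q(w) ≥ (1 - κ)‖w‖². Hence q(x) - q(z) ≥ ‖w‖².
  have hkey : ∀ n, ‖(w n : H)‖ ^ 2 ≤ ((t (x n) (x n)).re - l) -
      ((t (zD n) (zD n)).re - l * ‖(zD n : H)‖ ^ 2) := fun n => by
    have hxz : x n = zD n + w n := by simp [w]
    have h1 := congrArg Complex.re (hform n (w n))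
    have h2 : (t (x n) (x n)).re =
        (t (zD n) (zD n)).re + 2 * (t (zD n) (w n)).re + (t (w n) (w n)).re := by
      rw [hxz]
      simp only [map_add, LinearMap.add_apply, Complex.add_re]
      rw [hs (w n) (zD n), Complex.conj_re]
      ring
    have h3 : (inner ℂ (w n : H) (x n : H)).re =
        (inner ℂ (w n : H) (zD n : H)).re + ‖(w n : H)‖ ^ 2 := by
      rw [hxz, Submodule.coe_add, inner_add_right, Complex.add_re, inner_self_eq_norm_sq_to_K]
      norm_cast
    have h4 : (1 : ℝ) = ‖(zD n : H)‖ ^ 2 + 2 * (inner ℂ (w n : H) (zD n : H)).re +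
        ‖(w n : H)‖ ^ 2 := by
      have h5 := norm_add_sq (𝕜 := ℂ) (w n : H) (zD n : H)
      rw [← Submodule.coe_add, add_comm (w n), ← hxz, hx n] at h5
      simp only [RCLike.re_to_complex] at h5
      linarith
    rw [Complex.add_re, Complex.re_ofReal_mul, Complex.re_ofReal_mul, h3] at h1
    have h6 := hγ (w n)
    have h7 : l = l * (‖(zD n : H)‖ ^ 2 + 2 * (inner ℂ (w n : H) (zD n : H)).re +
        ‖(w n : H)‖ ^ 2) := by rw [← h4, mul_one]
    rw [hκdef] at h1 hκ
    nlinarith [mul_nonneg hκ.le (sq_nonneg ‖(w n : H)‖)]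
  have hw0 : Tendsto (fun n => ‖(w n : H)‖) atTop (𝓝 0) := by
    have h1 : Tendsto (fun n => ‖(w n : H)‖ ^ 2) atTop (𝓝 0) := by
      rw [Metric.tendsto_nhds]
      intro ε hε
      -- Minimality of `l` enters here: q(x n) → 0, while q(z n) is asymptotically nonnegative.
      have h2 := eventually_le_of_lowerBound hs hlow hl.2 hzM hzw (half_pos hε)
      have h3 : ∀ᶠ n in atTop, (t (x n) (x n)).re < l + ε / 2 := by
        have := (Complex.continuous_re.tendsto _).comp hxt
        exact this.eventually (gt_mem_nhds (by simpa using hε))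
      filter_upwards [h2, h3] with n h2 h3
      rw [dist_zero_right, Real.norm_eq_abs, abs_of_nonneg (sq_nonneg _)]
      linarith [hkey n]
    simpa using h1.sqrt
  have hres : ∀ n, A (z n) - (l : ℂ) • (z n : H) = (κ : ℂ) • (w n : H) := fun n => by
    have h1 : (w n : H) = x n - (κ : ℂ) • (v n : H) := rfl
    have h2 : (z n : H) = (κ : ℂ) • (v n : H) := rfl
    have h3 : A (v n) = x n - (γ : ℂ) • (v n : H) := by rw [← hv n]; abel
    rw [h1, h2, LinearPMap.map_smul, h3, hκdef]
    push_cast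
    module
  obtain ⟨N, hN⟩ := eventually_atTop.mp (hw0.eventually (gt_mem_nhds (half_pos one_pos)))
  have hzn : ∀ n, 1 / 2 ≤ ‖(z (n + N) : H)‖ := fun n => by
    have h1 := norm_sub_norm_le (x (n + N) : H) (w (n + N) : H)
    have h2 : (x (n + N) : H) - (w (n + N) : H) = z (n + N) := sub_sub_cancel _ _
    rw [h2, hx] at h1
    linarith [hN (n + N) (Nat.le_add_left _ _)]
  have hz0 : ∀ n, (z (n + N) : H) ≠ 0 := fun n h0 => by
    have h1 := hzn n
    rw [h0, norm_zero] at h1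
    linarith
  have hinv : ∀ n, ‖((‖(z (n + N) : H)‖⁻¹ : ℝ) : ℂ)‖ ≤ 2 := fun n => by
    rw [Complex.norm_real, norm_inv, norm_norm]
    exact inv_le_of_inv_le₀ two_pos (by linarith [hzn n])
  refine ⟨fun n => ((‖(z (n + N) : H)‖⁻¹ : ℝ) : ℂ) • z (n + N), fun n => ?_, ?_, ?_⟩
  · simpa using norm_normalize (hz0 n)
  · have h1 : WeaklyNull fun n => (z (n + N) : H) :=
      fun y => (hzw y).comp (tendsto_add_atTop_nat N)
    exact h1.smul_of_bounded hinv
  · have h1 := (hw0.comp (tendsto_add_atTop_nat N)).const_mul (2 * κ)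
    rw [mul_zero] at h1
    refine squeeze_zero (fun _ => norm_nonneg _) (fun n => ?_) h1
    have h2 : ∀ c : ℂ, A (c • z (n + N)) - (l : ℂ) • ((c • z (n + N) : A.domain) : H) =
        c • (κ : ℂ) • (w (n + N) : H) := fun c => by
      rw [LinearPMap.map_smul, Submodule.coe_smul, smul_comm (l : ℂ), ← smul_sub, hres]
    rw [h2, norm_smul, norm_smul, Complex.norm_real κ, Real.norm_eq_abs, abs_of_pos hκ, mul_assoc]
    exact mul_le_mul_of_nonneg_right (hinv n) (by positivity)

/-- If the essential numerical range of the form is nonempty, then it has a smallest point, which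
is also the smallest point of the essential spectrum of the operator. -/
theorem Corresponds.exists_isLeast (hcor : Corresponds A t) (hA : IsSelfAdjoint A)
    (hs : IsSymmetricForm t) (hsec : IsSectorial t) (hc : IsClosedForm t)
    (hne : (realEssNumRange t).Nonempty) :
    ∃ l, IsLeast (realEssNumRange t) l ∧ IsLeast (realEssSpectrum A) l := by
  obtain ⟨γ, -, hγ⟩ := hsec.exists_coercive
  obtain ⟨v, hv⟩ := hsec.exists_lower_bound
  have hl := (isClosed_realEssNumRange t).isLeast_csInf hne
    ⟨v, fun s hs => lower_bound_realEssNumRange hv hs⟩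
  exact ⟨_, hl, hcor.mem_realEssSpectrum hA hs hc hγ hl,
    fun s hs => hl.2 (hcor.realEssSpectrum_subset hs)⟩

end Operator

end TypeBFamily

namespace TypeBFamily

/-! ### The uniform second order expansion of the forms. -/

section Expansion

universe u

variable {H : Type u} [NormedAddCommGroup H] [InnerProductSpace ℂ H]
  {D : Submodule ℂ H} {U : Set ℂ} {a : ℂ → SesqForm D}

theorem IsHolomorphicTypeA.coeff_zero (h : IsHolomorphicTypeA U a) : h.coeff 0 = a 0 := by
  refine LinearMap.ext₂ fun x y => ?_
  simp [IsHolomorphicTypeA.coeff]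

theorem IsHolomorphicTypeA.coeff_one_apply (h : IsHolomorphicTypeA U a) (x y : D) :
    h.coeff 1 x y = deriv (fun t => a t x y) 0 := by
  simp [IsHolomorphicTypeA.coeff]

/-- The first order coefficient as a limit along the real axis. -/
theorem IsHolomorphicTypeA.tendsto_quotient (h : IsHolomorphicTypeA U a) (x y : D) :
    Tendsto (fun t : ℝ => (t : ℂ)⁻¹ * (a t x y - a 0 x y)) (𝓝[≠] 0) (𝓝 (h.coeff 1 x y)) := by
  rw [h.coeff_one_apply]
  have hd := ((h.holomorphic x y).differentiableAt (h.isOpen.mem_nhds h.zero_mem)).hasDerivAt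
  have h2 : Tendsto (fun t : ℝ => (t : ℂ)) (𝓝[≠] 0) (𝓝[≠] 0) := by
    refine tendsto_nhdsWithin_iff.mpr ⟨?_, ?_⟩
    · exact (Complex.continuous_ofReal.tendsto' 0 0 (by simp)).mono_left nhdsWithin_le_nhds
    · filter_upwards [self_mem_nhdsWithin] with t ht
      simpa using ht
  refine (hd.tendsto_slope.comp h2).congr fun t => ?_
  simp [slope_def_field, div_eq_inv_mul]

/-- Difference quotients of first and second order of a holomorphic function are bounded. -/
theorem exists_bound_quotients {f : ℂ → ℂ} (hU : IsOpen U) {r : ℝ} (hr : 0 < r)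
    (hrU : Metric.closedBall (0 : ℂ) r ⊆ U) (hf : DifferentiableOn ℂ f U) :
    ∃ C, ∀ z ∈ Metric.closedBall (0 : ℂ) r, ‖z⁻¹ * (f z - f 0)‖ ≤ C ∧
      ‖(z ^ 2)⁻¹ * (f z - f 0 - z * deriv f 0)‖ ≤ C := by
  have hU0 : U ∈ 𝓝 (0 : ℂ) := hU.mem_nhds (hrU (Metric.mem_closedBall_self hr.le))
  -- The quotients are iterated `dslope`s, which are holomorphic across 0 and so bounded on the
  -- compact disc. At `z = 0` the convention `0⁻¹ = 0` leaves only `0 ≤ C` to check.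
  have hg := (Complex.differentiableOn_dslope hU0).mpr hf
  have hk := (Complex.differentiableOn_dslope hU0).mpr hg
  obtain ⟨C₁, h1⟩ := (isCompact_closedBall (0 : ℂ) r).exists_bound_of_continuousOn
    (hg.continuousOn.mono hrU)
  obtain ⟨C₂, h2⟩ := (isCompact_closedBall (0 : ℂ) r).exists_bound_of_continuousOn
    (hk.continuousOn.mono hrU)
  have hd : ‖deriv f 0‖ ≤ C₁ := by
    simpa using h1 0 (Metric.mem_closedBall_self hr.le)
  refine ⟨max C₁ C₂, fun z hz => ?_⟩
  refine ⟨?_, ?_⟩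
  · rcases eq_or_ne z 0 with rfl | hz0
    · simpa using Or.inl ((norm_nonneg _).trans hd)
    · refine le_trans ?_ (le_max_left C₁ C₂)
      have := h1 z hz
      rwa [dslope_of_ne _ hz0, slope_def_field, sub_zero, div_eq_inv_mul] at this
  · rcases eq_or_ne z 0 with rfl | hz0
    · simpa using Or.inl ((norm_nonneg _).trans hd)
    · refine le_trans (le_of_eq ?_) ((h2 z hz).trans (le_max_right C₁ C₂))
      rw [dslope_of_ne _ hz0, slope_def_field, sub_zero, dslope_same, dslope_of_ne _ hz0,
        slope_def_field, sub_zero]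
      congr 1
      field_simp

variable [CompleteSpace H] {A : ℝ → H →ₗ.[ℂ] H}

/-- The derivative at 0 may be taken along real `t`, where the difference quotients are symmetric.
-/
theorem IsSelfAdjointTypeB.isSymmetricForm_coeff_one (h : IsSelfAdjointTypeB U A a) :
    IsSymmetricForm (h.typeA.coeff 1) := by
  intro x y
  refine tendsto_nhds_unique (h.typeA.tendsto_quotient x y) ?_
  refine ((Complex.continuous_conj.tendsto _).comp (h.typeA.tendsto_quotient y x)).congr' ?_
  have hU : ∀ᶠ t : ℝ in 𝓝[≠] 0, (t : ℂ) ∈ U := by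
    refine Filter.Eventually.filter_mono nhdsWithin_le_nhds ?_
    exact (Complex.continuous_ofReal.tendsto' 0 0 (by simp)).eventually
      (h.typeA.isOpen.mem_nhds h.typeA.zero_mem)
  filter_upwards [hU] with t ht
  have h0 : IsSymmetricForm (a 0) := by
    simpa using h.symmetric 0 (by simpa using h.typeA.zero_mem)
  simp only [Function.comp_apply]
  rw [map_mul, map_inv₀, Complex.conj_ofReal, map_sub, ← h.symmetric t ht x y, ← h0 x y]

/-- The expansion of the forms to second order, with a remainder that is controlled by the form
norm of `a(0)`. -/
theorem IsSelfAdjointTypeB.exists_expansion (h : IsSelfAdjointTypeB U A a) {γ : ℝ}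
    (hγ : ∀ x : D, ‖(x : H)‖ ^ 2 ≤ (a 0 x x).re + γ * ‖(x : H)‖ ^ 2) :
    ∃ r C : ℝ, 0 < r ∧ 0 ≤ C ∧ (∀ t : ℝ, |t| ≤ r → (t : ℂ) ∈ U) ∧ ∀ x : D,
      ‖h.typeA.coeff 1 x x‖ ≤ C * ((a 0 x x).re + γ * ‖(x : H)‖ ^ 2) ∧
      ∀ t : ℝ, |t| ≤ r → ‖a t x x - a 0 x x - t * h.typeA.coeff 1 x x‖ ≤
        C * t ^ 2 * ((a 0 x x).re + γ * ‖(x : H)‖ ^ 2) := by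
  have h0U : ((0 : ℝ) : ℂ) ∈ U := by simpa using h.typeA.zero_mem
  have hs0 : IsSymmetricForm (a 0) := by simpa using h.symmetric 0 h0U
  obtain ⟨E, _, _, e, _, he⟩ := exists_isFormSpace hs0 (h.typeA.closed 0 h.typeA.zero_mem) hγ
  obtain ⟨r, hr, hrU⟩ := Metric.nhds_basis_closedBall.mem_iff.mp
    (h.typeA.isOpen.mem_nhds h.typeA.zero_mem)
  have hball : ∀ t : ℝ, |t| ≤ r → (t : ℂ) ∈ Metric.closedBall (0 : ℂ) r := fun t ht => by
    simpa using ht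
  let ι := {t : ℝ // |t| ≤ r}
  have hbd : ∀ t : ℝ, |t| ≤ r → ∃ M, ∀ x y : E, ‖a t (e x) (e y)‖ ≤ M * ‖x‖ * ‖y‖ := fun t ht => by
    have htU := hrU (hball t ht)
    exact he.exists_bound (h.symmetric t htU) (h.typeA.sectorial t htU) (h.typeA.closed t htU)
  have hbd0 : ∃ M, ∀ x y : E, ‖a 0 (e x) (e y)‖ ≤ M * ‖x‖ * ‖y‖ := by
    simpa using hbd 0 (by simpa using hr.le)
  have hq := fun x y : E => exists_bound_quotients h.typeA.isOpen hr hrU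
    (h.typeA.holomorphic (e x) (e y))
  let pull : SesqForm D → (E →ₗ[ℂ] E →ₗ⋆[ℂ] ℂ) := fun s =>
    LinearMap.mk₂'ₛₗ (RingHom.id ℂ) (starRingEnd ℂ) (fun x y => s (e x) (e y))
      (by intros; simp) (by intros; simp) (by intros; simp) (by intros; simp)
  -- The closed graph bounds depend on `t`; the pointwise bounds `hq` make them uniform. The limit
  -- then bounds `a₁`, which the second order remainder needs.
  obtain ⟨C₁, hC₁⟩ := exists_uniform_bound
    (fun t : ι => pull ((t.1 : ℂ)⁻¹ • (a t.1 - a 0)))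
    (fun t => by
      obtain ⟨M, hM⟩ := hbd t.1 t.2
      obtain ⟨M₀, hM₀⟩ := hbd0
      refine ⟨‖(t.1 : ℂ)⁻¹‖ * (M + M₀), fun x y => ?_⟩
      have e1 : pull ((t.1 : ℂ)⁻¹ • (a t.1 - a 0)) x y =
        (t.1 : ℂ)⁻¹ * (a t.1 (e x) (e y) - a 0 (e x) (e y)) := rfl
      rw [e1, norm_mul, mul_assoc, mul_assoc]
      gcongr
      linarith [norm_sub_le (a t.1 (e x) (e y)) (a 0 (e x) (e y)), hM x y, hM₀ x y])
    (fun x y => by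
      obtain ⟨C, hC⟩ := hq x y
      exact ⟨C, fun t => (hC t.1 (hball t.1 t.2)).1⟩)
  have h1 : ∀ x y : E, ‖h.typeA.coeff 1 (e x) (e y)‖ ≤ C₁ * ‖x‖ * ‖y‖ := fun x y => by
    have h3 := (h.typeA.tendsto_quotient (e x) (e y)).norm
    refine le_of_tendsto h3 ?_
    have h4 : ∀ᶠ t : ℝ in 𝓝[≠] 0, |t| ≤ r := by
      refine Filter.Eventually.filter_mono nhdsWithin_le_nhds ?_
      filter_upwards [Metric.closedBall_mem_nhds (0 : ℝ) hr] with t ht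
      simpa using ht
    filter_upwards [h4] with t ht
    exact hC₁ ⟨t, ht⟩ x y
  obtain ⟨C₂, hC₂⟩ := exists_uniform_bound
    (fun t : ι => pull (((t.1 : ℂ) ^ 2)⁻¹ • (a t.1 - a 0 - (t.1 : ℂ) • h.typeA.coeff 1)))
    (fun t => by
      obtain ⟨M, hM⟩ := hbd t.1 t.2
      obtain ⟨M₀, hM₀⟩ := hbd0
      refine ⟨‖((t.1 : ℂ) ^ 2)⁻¹‖ * (M + M₀ + |t.1| * C₁), fun x y => ?_⟩
      have e1 : pull (((t.1 : ℂ) ^ 2)⁻¹ • (a t.1 - a 0 - (t.1 : ℂ) • h.typeA.coeff 1)) x y =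
        ((t.1 : ℂ) ^ 2)⁻¹ * (a t.1 (e x) (e y) - a 0 (e x) (e y) -
          t.1 * h.typeA.coeff 1 (e x) (e y)) := rfl
      rw [e1, norm_mul, mul_assoc, mul_assoc]
      gcongr
      have e2 : ‖(t.1 : ℂ) * h.typeA.coeff 1 (e x) (e y)‖ ≤ |t.1| * (C₁ * ‖x‖ * ‖y‖) := by
        rw [norm_mul, Complex.norm_real, Real.norm_eq_abs]
        gcongr
        exact h1 x y
      linarith [norm_sub_le (a t.1 (e x) (e y) - a 0 (e x) (e y))
        (t.1 * h.typeA.coeff 1 (e x) (e y)),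
        norm_sub_le (a t.1 (e x) (e y)) (a 0 (e x) (e y)), hM x y, hM₀ x y])
    (fun x y => by
      obtain ⟨C, hC⟩ := hq x y
      refine ⟨C, fun t => ?_⟩
      have e1 : pull (((t.1 : ℂ) ^ 2)⁻¹ • (a t.1 - a 0 - (t.1 : ℂ) • h.typeA.coeff 1)) x y =
        ((t.1 : ℂ) ^ 2)⁻¹ * (a t.1 (e x) (e y) - a 0 (e x) (e y) -
          t.1 * h.typeA.coeff 1 (e x) (e y)) := rfl
      rw [e1, h.typeA.coeff_one_apply]
      exact (hC t.1 (hball t.1 t.2)).2)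
  refine ⟨r, max (max C₁ C₂) 0, hr, le_max_right _ _, fun t ht => hrU (hball t ht), fun x => ?_⟩
  obtain ⟨x, rfl⟩ := e.surjective x
  rw [← he.norm_sq]
  refine ⟨?_, fun t ht => ?_⟩
  · refine (h1 x x).trans ?_
    rw [mul_assoc, ← sq]
    gcongr
    exact (le_max_left _ _).trans (le_max_left _ _)
  · rcases eq_or_ne t 0 with rfl | ht0
    · simp
    have h2 := hC₂ ⟨t, ht⟩ x x
    have e1 : pull (((t : ℂ) ^ 2)⁻¹ • (a t - a 0 - (t : ℂ) • h.typeA.coeff 1)) x x =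
        ((t : ℂ) ^ 2)⁻¹ * (a t (e x) (e x) - a 0 (e x) (e x) -
          t * h.typeA.coeff 1 (e x) (e x)) := rfl
    simp only at h2
    rw [e1, norm_mul, norm_inv, norm_pow, Complex.norm_real, Real.norm_eq_abs, sq_abs,
      inv_mul_le_iff₀ (by positivity), mul_assoc, ← sq] at h2
    calc _ ≤ t ^ 2 * (C₂ * ‖x‖ ^ 2) := h2
      _ = C₂ * t ^ 2 * ‖x‖ ^ 2 := by ring
      _ ≤ _ := by
        gcongr
        exact (le_max_right _ _).trans (le_max_left _ _)

end Expansion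

end TypeBFamily

namespace TypeBFamily

/-! ### Bounds for the bottom of the perturbed essential numerical range. -/

section Perturbation

universe u

variable {H : Type u} [NormedAddCommGroup H] [InnerProductSpace ℂ H] {D : Submodule ℂ H}

theorem add_I_smul_apply {s₀ s₁ : SesqForm D} (h₀ : IsSymmetricForm s₀) (h₁ : IsSymmetricForm s₁)
    (x : D) : (s₀ + Complex.I • s₁) x x = ((s₀ x x).re : ℂ) + Complex.I * ((s₁ x x).re : ℂ) := by
  rw [h₀.ofReal_re, h₁.ofReal_re]
  rfl

theorem exists_seq_of_mem_essNumRange {s₀ s₁ : SesqForm D} (h₀ : IsSymmetricForm s₀)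
    (h₁ : IsSymmetricForm s₁) {α β : ℝ}
    (h : (α : ℂ) + Complex.I * β ∈ essNumRange (s₀ + Complex.I • s₁)) :
    ∃ x : ℕ → D, (∀ n, ‖(x n : H)‖ = 1) ∧ WeaklyNull (fun n => (x n : H)) ∧
      Tendsto (fun n => (s₀ (x n) (x n)).re) atTop (𝓝 α) ∧
      Tendsto (fun n => (s₁ (x n) (x n)).re) atTop (𝓝 β) := by
  obtain ⟨x, hx, hw, ht⟩ := h
  refine ⟨x, hx, hw, ?_, ?_⟩
  · simpa [Function.comp_def, h₀.im_eq_zero, h₁.im_eq_zero] using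
      (Complex.continuous_re.tendsto _).comp ht
  · simpa [Function.comp_def, h₀.im_eq_zero, h₁.im_eq_zero] using
      (Complex.continuous_im.tendsto _).comp ht

/-- Since both forms are symmetric, one complex value encodes the pair of real values, and a single
compactness argument serves both. -/
theorem exists_subseq_pair {s₀ s₁ : SesqForm D} (h₀ : IsSymmetricForm s₀)
    (h₁ : IsSymmetricForm s₁) {x : ℕ → D} (hx : ∀ n, ‖(x n : H)‖ = 1)
    (hw : WeaklyNull fun n => (x n : H)) {M₀ M₁ : ℝ} (hM₀ : ∀ n, |(s₀ (x n) (x n)).re| ≤ M₀)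
    (hM₁ : ∀ n, |(s₁ (x n) (x n)).re| ≤ M₁) :
    ∃ (α β : ℝ) (φ : ℕ → ℕ), StrictMono φ ∧
      Tendsto (fun n => (s₀ (x (φ n)) (x (φ n))).re) atTop (𝓝 α) ∧
      Tendsto (fun n => (s₁ (x (φ n)) (x (φ n))).re) atTop (𝓝 β) ∧
      (α : ℂ) + Complex.I * β ∈ essNumRange (s₀ + Complex.I • s₁) ∧
      α ∈ realEssNumRange s₀ := by
  have hb : ∀ n, ‖(s₀ + Complex.I • s₁) (x n) (x n)‖ ≤ M₀ + M₁ := fun n => by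
    rw [add_I_smul_apply h₀ h₁]
    refine (norm_add_le _ _).trans ?_
    rw [norm_mul, Complex.norm_I, one_mul, Complex.norm_real, Complex.norm_real]
    exact add_le_add (hM₀ n) (hM₁ n)
  obtain ⟨z, hz, φ, hφ, hlim⟩ := exists_subseq_mem_essNumRange hx hw hb
  have hre : Tendsto (fun n => (s₀ (x (φ n)) (x (φ n))).re) atTop (𝓝 z.re) := by
    simpa [Function.comp_def, h₀.im_eq_zero, h₁.im_eq_zero] using
      (Complex.continuous_re.tendsto _).comp hlim
  refine ⟨z.re, z.im, φ, hφ, hre, ?_, ?_, fun n => x (φ n), fun n => hx _, hw.comp hφ, ?_⟩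
  · simpa [Function.comp_def, h₀.im_eq_zero, h₁.im_eq_zero] using
      (Complex.continuous_im.tendsto _).comp hlim
  · rwa [mul_comm, Complex.re_add_im]
  · simpa [Function.comp_def, h₀.ofReal_re] using (Complex.continuous_ofReal.tendsto _).comp hre

theorem IsSymmetricForm.exists_mem_le {s : SesqForm D} (hs : IsSymmetricForm s) {x : ℕ → D}
    (hx : ∀ n, ‖(x n : H)‖ = 1) (hw : WeaklyNull fun n => (x n : H)) {M : ℝ}
    (hM : ∀ n, |(s (x n) (x n)).re| ≤ M) {f : ℕ → ℝ} {b : ℝ} (hf : Tendsto f atTop (𝓝 b))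
    (hle : ∀ n, (s (x n) (x n)).re ≤ f n) : ∃ l ∈ realEssNumRange s, l ≤ b := by
  obtain ⟨z, hz, φ, hφ, hlim⟩ := exists_subseq_mem_essNumRange (M := M) hx hw fun n => by
    rw [← hs.ofReal_re, Complex.norm_real]
    exact hM n
  refine ⟨z.re, ?_, ?_⟩
  · change ((z.re : ℝ) : ℂ) ∈ essNumRange s
    rwa [show ((z.re : ℝ) : ℂ) = z from
      Complex.ext (by simp) (by simp [hs.im_eq_zero_of_mem hz])]
  · exact le_of_tendsto_of_tendsto' ((Complex.continuous_re.tendsto _).comp hlim)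
      (hf.comp hφ.tendsto_atTop) fun n => hle _

theorem exists_abs_le_of_tendsto {f : ℕ → ℝ} {b : ℝ} (hf : Tendsto f atTop (𝓝 b)) :
    ∃ M, ∀ n, |f n| ≤ M := by
  obtain ⟨M, hM⟩ := (Metric.isBounded_range_of_tendsto f hf).exists_norm_le
  exact ⟨M, fun n => hM _ ⟨n, rfl⟩⟩

/-- Points of the essential numerical range whose imaginary part is below all those on the
imaginary axis stay away from the imaginary axis. -/
theorem exists_pos_le_re [CompleteSpace H] {s : SesqForm D} {ω : ℝ}
    (hω : ω ∈ lowerBounds {w : ℝ | Complex.I * (w : ℂ) ∈ essNumRange s}) (B : ℝ) {c : ℝ}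
    (hc : c < ω) : ∃ δ > 0, ∀ α β : ℝ, (α : ℂ) + Complex.I * β ∈ essNumRange s → 0 ≤ α →
      |β| ≤ B → β ≤ c → δ ≤ α := by
  -- On this compact set the real part attains its minimum. The minimum is not 0, since a point on
  -- the imaginary axis would have imaginary part at least `ω > c`.
  let K : Set ℂ := essNumRange s ∩ (Set.Icc 0 1 ×ℂ (Set.Icc (-B) B ∩ Set.Iic c))
  have hK : IsCompact K :=
    (isCompact_Icc.reProdIm (isCompact_Icc.inter_right isClosed_Iic)).inter_left
      (isClosed_essNumRange s)
  have hmem : ∀ α β : ℝ, (α : ℂ) + Complex.I * β ∈ essNumRange s → 0 ≤ α → |β| ≤ B → β ≤ c →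
      α ≤ 1 → (α : ℂ) + Complex.I * β ∈ K := fun α β h h0 hB hβ h1 => by
    refine ⟨h, ?_⟩
    rw [Complex.mem_reProdIm]
    simpa [h0, h1, hβ] using abs_le.mp hB
  rcases K.eq_empty_or_nonempty with hKe | hKn
  · refine ⟨1, one_pos, fun α β h h0 hB hβ => ?_⟩
    by_contra! h1
    have := hmem α β h h0 hB hβ h1.le
    rw [hKe] at this
    exact this
  · obtain ⟨z, hz, hmin⟩ := hK.exists_isMinOn hKn Complex.continuous_re.continuousOn
    have hz2 := Complex.mem_reProdIm.mp hz.2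
    have hpos : 0 < z.re := by
      refine lt_of_le_of_ne hz2.1.1 fun h0 => ?_
      have h1 : z = Complex.I * (z.im : ℂ) := Complex.ext (by simp [← h0]) (by simp)
      have h2 : ω ≤ z.im := hω (by
        change Complex.I * ((z.im : ℝ) : ℂ) ∈ essNumRange s
        rw [← h1]
        exact hz.1)
      have h3 : z.im ≤ c := hz2.2.2
      linarith
    refine ⟨min 1 z.re, lt_min one_pos hpos, fun α β h h0 hB hβ => ?_⟩
    rcases le_total α 1 with h1 | h1
    · refine (min_le_right _ _).trans ?_
      simpa using hmin (hmem α β h h0 hB hβ h1)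
    · exact (min_le_left _ _).trans h1

variable [CompleteSpace H] {U : Set ℂ} {A : ℝ → H →ₗ.[ℂ] H} {a : ℂ → SesqForm D}

/-- The conclusions of the second order expansion on unit vectors, in real terms. -/
structure IsExpansionBound (s₀ s₁ : SesqForm D) (s : ℝ → SesqForm D) (r C γ : ℝ) : Prop where
  nonneg : 0 ≤ C
  gamma_nonneg : 0 ≤ γ
  coercive : ∀ x : D, ‖(x : H)‖ = 1 → 1 ≤ (s₀ x x).re + γ
  first : ∀ x : D, ‖(x : H)‖ = 1 → |(s₁ x x).re| ≤ C * ((s₀ x x).re + γ)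
  second : ∀ x : D, ‖(x : H)‖ = 1 → ∀ t : ℝ, |t| ≤ r →
    |(s t x x).re - (s₀ x x).re - t * (s₁ x x).re| ≤ C * t ^ 2 * ((s₀ x x).re + γ)

omit [CompleteSpace H] in
theorem IsExpansionBound.exists_upper {s₀ s₁ : SesqForm D} {s : ℝ → SesqForm D} {r C γ : ℝ}
    (h : IsExpansionBound s₀ s₁ s r C γ) (h₀ : IsSymmetricForm s₀) (h₁ : IsSymmetricForm s₁)
    {w : ℝ} (hw : Complex.I * (w : ℂ) ∈ essNumRange (s₀ + Complex.I • s₁)) {t : ℝ} (ht : |t| ≤ r)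
    (hs : IsSymmetricForm (s t)) :
    ∃ l ∈ realEssNumRange (s t), l ≤ t * w + C * t ^ 2 * γ := by
  obtain ⟨x, hx, hxw, h0, h1⟩ := exists_seq_of_mem_essNumRange h₀ h₁ (α := 0) (β := w)
    (by simpa using hw)
  have hf := (h0.add (h1.const_mul t)).add ((h0.add_const γ).const_mul (C * t ^ 2))
  have hg := (h0.add (h1.const_mul t)).sub ((h0.add_const γ).const_mul (C * t ^ 2))
  obtain ⟨M, hM⟩ := exists_abs_le_of_tendsto hf
  obtain ⟨M', hM'⟩ := exists_abs_le_of_tendsto hg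
  rw [zero_add, zero_add] at hf
  refine hs.exists_mem_le hx hxw (M := max M M') (fun n => ?_) hf fun n => ?_
  · have h2 := abs_le.mp (h.second (x n) (hx n) t ht)
    have h3 := abs_le.mp (hM n)
    have h4 := abs_le.mp (hM' n)
    have h5 := le_max_left M M'
    have h6 := le_max_right M M'
    rw [abs_le]
    constructor <;> linarith
  · linarith [abs_le.mp (h.second (x n) (hx n) t ht)]

omit [CompleteSpace H] in
theorem IsExpansionBound.exists_lower {s₀ s₁ : SesqForm D} {s : ℝ → SesqForm D} {r C γ : ℝ}
    (h : IsExpansionBound s₀ s₁ s r C γ) (h₀ : IsSymmetricForm s₀) (h₁ : IsSymmetricForm s₁)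
    (hb : 0 ∈ lowerBounds (realEssNumRange s₀)) {ω t : ℝ} (ht0 : 0 < t) (htr : t ≤ r) (ht1 : t ≤ 1)
    (htC : 4 * C * t ≤ 1) {l : ℝ} (hl : l ∈ realEssNumRange (s t))
    (hlω : l ≤ t * ω + C * t ^ 2 * γ) :
    ∃ α β : ℝ, (α : ℂ) + Complex.I * β ∈ essNumRange (s₀ + Complex.I • s₁) ∧ 0 ≤ α ∧
      α ≤ t * (2 * (|ω| + 3 * C * γ)) ∧ |β| ≤ C * (2 * (|ω| + 3 * C * γ) + γ) ∧
      t * β - t ^ 2 * (C * (2 * (|ω| + 3 * C * γ) + γ)) ≤ l := by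
  have hC := h.nonneg
  have hγ := h.gamma_nonneg
  have htr' : |t| ≤ r := by rwa [abs_of_pos ht0]
  have htt : t ^ 2 ≤ t := by nlinarith
  obtain ⟨x, hx, hxw, hlim⟩ := hl
  have hlre : Tendsto (fun n => (s t (x n) (x n)).re) atTop (𝓝 l) :=
    (Complex.continuous_re.tendsto _).comp hlim
  obtain ⟨P, hP⟩ := exists_abs_le_of_tendsto hlre
  have hlow : ∀ n, (s₀ (x n) (x n)).re + t * (s₁ (x n) (x n)).re -
      C * t ^ 2 * ((s₀ (x n) (x n)).re + γ) ≤ (s t (x n) (x n)).re := fun n => by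
    linarith [abs_le.mp (h.second (x n) (hx n) t htr')]
  -- By `4 * C * t ≤ 1`, the first order term and the remainder together take at most half of `q`.
  have hq : ∀ n, (s₀ (x n) (x n)).re + γ ≤ 2 * (P + γ) := fun n => by
    set q := (s₀ (x n) (x n)).re + γ with hqdef
    have h1 := abs_le.mp (h.first (x n) (hx n))
    have h2 := h.coercive (x n) (hx n)
    have h3 : -(t * (C * q)) ≤ t * (s₁ (x n) (x n)).re := by nlinarith
    have h4 : C * t ^ 2 * q ≤ C * t * q := by gcongr
    have h5 : 4 * C * t * q ≤ 1 * q := by gcongr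
    linarith [hlow n, abs_le.mp (hP n)]
  have hM0 : ∀ n, |(s₀ (x n) (x n)).re| ≤ 2 * (P + γ) + γ := fun n => by
    have h2 := h.coercive (x n) (hx n)
    have h3 := hq n
    rw [abs_le]
    constructor <;> linarith
  have hM1 : ∀ n, |(s₁ (x n) (x n)).re| ≤ C * (2 * (P + γ)) := fun n =>
    (h.first (x n) (hx n)).trans (by gcongr; exact hq n)
  obtain ⟨α, β, φ, hφ, hα, hβ, hmem, hα0⟩ := exists_subseq_pair h₀ h₁ hx hxw hM0 hM1
  have hα0 : 0 ≤ α := hb hα0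
  have hβα : |β| ≤ C * (α + γ) := le_of_tendsto_of_tendsto' hβ.abs
    ((hα.add_const γ).const_mul C) fun n => h.first _ (hx _)
  have hl' : α + t * β - C * t ^ 2 * (α + γ) ≤ l := le_of_tendsto_of_tendsto'
    ((hα.add (hβ.const_mul t)).sub ((hα.add_const γ).const_mul (C * t ^ 2)))
    (hlre.comp hφ.tendsto_atTop) fun n => hlow _
  have hCγ : 0 ≤ C * γ := mul_nonneg hC hγ
  -- Inserting `|β| ≤ C(α + γ)` and `t² ≤ t` into `hl'` and `hlω` gives α - 2Ct(α + γ) ≤ t|ω| + Ctγ;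
  -- then 2Ctα ≤ α/2 is absorbed.
  have hαK : α ≤ t * (2 * (|ω| + 3 * C * γ)) := by
    have h1 : -(t * (C * (α + γ))) ≤ t * β := by nlinarith [abs_le.mp hβα]
    have h2 : C * t ^ 2 * (α + γ) ≤ C * t * (α + γ) := by gcongr
    have h3 : C * t ^ 2 * γ ≤ C * t * γ := by gcongr
    have h4 : 4 * C * t * α ≤ 1 * α := by gcongr
    have h5 : t * ω ≤ t * |ω| := by gcongr; exact le_abs_self ω
    linarith
  have hαK' : α ≤ 2 * (|ω| + 3 * C * γ) := hαK.trans (mul_le_of_le_one_left (by positivity) ht1)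
  refine ⟨α, β, hmem, hα0, hαK, hβα.trans (by gcongr), ?_⟩
  have h1 : C * t ^ 2 * (α + γ) ≤ C * t ^ 2 * (2 * (|ω| + 3 * C * γ) + γ) := by gcongr
  linarith

theorem IsSelfAdjointTypeB.exists_isExpansionBound (h : IsSelfAdjointTypeB U A a) :
    ∃ r C γ : ℝ, 0 < r ∧ (∀ t : ℝ, |t| ≤ r → (t : ℂ) ∈ U) ∧
      IsExpansionBound (a 0) (h.typeA.coeff 1) (fun t : ℝ => a t) r C γ := by
  obtain ⟨γ, hγ0, hγ⟩ := (h.typeA.sectorial 0 h.typeA.zero_mem).exists_coercive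
  obtain ⟨r, C, hr, hC, hU, hx⟩ := h.exists_expansion hγ
  refine ⟨r, C, γ, hr, hU, hC, hγ0, fun x hx1 => ?_, fun x hx1 => ?_, fun x hx1 t ht => ?_⟩
  · simpa [hx1] using hγ x
  · have h1 := (hx x).1
    rw [hx1, one_pow, mul_one] at h1
    exact (Complex.abs_re_le_norm _).trans h1
  · have h1 := (hx x).2 t ht
    rw [hx1, one_pow, mul_one] at h1
    refine le_trans (le_of_eq ?_) ((Complex.abs_re_le_norm _).trans h1)
    simp

end Perturbation

end TypeBFamily

/-! ### The limit of Σ(t)/t. -/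

theorem proposition3p2 {H : Type*} [NormedAddCommGroup H] [InnerProductSpace ℂ H]
    [CompleteSpace H] {D : Submodule ℂ H} {U : Set ℂ} {A : ℝ → H →ₗ.[ℂ] H}
    {a : ℂ → TypeBFamily.SesqForm D} (h : TypeBFamily.IsSelfAdjointTypeB U A a)
    (h0 : IsLeast (TypeBFamily.realEssSpectrum (A 0)) 0) :
    (∀ᶠ t in 𝓝[>] (0 : ℝ),
      IsLeast (TypeBFamily.realEssSpectrum (A t)) (TypeBFamily.bottom (A t))) ∧
    ∃ ω : ℝ,
      IsLeast {w : ℝ | Complex.I * (w : ℂ) ∈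
        TypeBFamily.essNumRange (h.typeA.coeff 0 + Complex.I • h.typeA.coeff 1)} ω ∧
      Tendsto (fun t : ℝ => TypeBFamily.bottom (A t) / t) (𝓝[>] (0 : ℝ)) (𝓝 ω) := by
  open TypeBFamily in
  rw [h.typeA.coeff_zero]
  obtain ⟨r, C, γ, hr, hU, hE⟩ := h.exists_isExpansionBound
  have h0U : ((0 : ℝ) : ℂ) ∈ U := hU 0 (by simpa using hr.le)
  have hs₀ : IsSymmetricForm (a 0) := by simpa using h.symmetric 0 h0U
  have hs₁ := h.isSymmetricForm_coeff_one
  have hcor₀ : Corresponds (A 0) (a 0) := by simpa using h.corresponds 0 h0U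
  have hb : 0 ∈ lowerBounds (realEssNumRange (a 0)) := by
    obtain ⟨l, hl, hl'⟩ := hcor₀.exists_isLeast (h.selfAdjoint 0 h0U) hs₀
      (h.typeA.sectorial 0 h.typeA.zero_mem) (h.typeA.closed 0 h.typeA.zero_mem)
      ⟨0, hcor₀.realEssSpectrum_subset h0.1⟩
    rw [h0.unique hl']
    exact hl.2
  set S : Set ℝ := {w : ℝ | Complex.I * (w : ℂ) ∈
    essNumRange (a 0 + Complex.I • h.typeA.coeff 1)} with hS
  have hSne : S.Nonempty := by
    obtain ⟨x, hx, hxw, hlim⟩ := hcor₀.realEssSpectrum_subset h0.1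
    have h1 : Tendsto (fun n => (a 0 (x n) (x n)).re) atTop (𝓝 0) := by
      simpa [Function.comp_def] using (Complex.continuous_re.tendsto _).comp hlim
    obtain ⟨M, hM⟩ := exists_abs_le_of_tendsto h1
    obtain ⟨α, β, φ, hφ, hα, -, hmem, -⟩ := exists_subseq_pair hs₀ hs₁ hx hxw hM
      (M₁ := C * (M + γ)) (fun n => (hE.first _ (hx n)).trans
        (mul_le_mul_of_nonneg_left (by linarith [abs_le.mp (hM n)]) hE.nonneg))
    obtain rfl : α = 0 := tendsto_nhds_unique hα (h1.comp hφ.tendsto_atTop)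
    exact ⟨β, by simpa [hS] using hmem⟩
  have hSc : IsClosed S :=
    (isClosed_essNumRange _).preimage (continuous_const.mul Complex.continuous_ofReal)
  have hSb : BddBelow S := by
    refine ⟨-(C * γ), fun w hw => ?_⟩
    obtain ⟨x, hx, -, h1, h2⟩ := exists_seq_of_mem_essNumRange hs₀ hs₁ (α := 0) (β := w)
      (by simpa [hS] using hw)
    have h3 := (h1.add_const γ).const_mul C
    rw [zero_add] at h3
    exact le_of_tendsto_of_tendsto' h3.neg h2 fun n => (abs_le.mp (hE.first _ (hx n))).1
  have hω := hSc.isLeast_csInf hSne hSb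
  set ω := sInf S
  have hleast : ∀ t : ℝ, 0 < t → t ≤ r →
      IsLeast (realEssNumRange (a t)) (bottom (A t)) ∧
      IsLeast (realEssSpectrum (A t)) (bottom (A t)) ∧
      bottom (A t) ≤ t * ω + C * t ^ 2 * γ := fun t ht0 htr => by
    have htr' : |t| ≤ r := by rwa [abs_of_pos ht0]
    have htU := hU t htr'
    obtain ⟨l', hl', hle⟩ := hE.exists_upper hs₀ hs₁ hω.1 htr' (h.symmetric t htU)
    obtain ⟨l, hl, hlA⟩ := (h.corresponds t htU).exists_isLeast (h.selfAdjoint t htU)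
      (h.symmetric t htU) (h.typeA.sectorial t htU) (h.typeA.closed t htU) ⟨l', hl'⟩
    have hbl : bottom (A t) = l := hlA.csInf_eq
    rw [hbl]
    exact ⟨hl, hlA, (hl.2 hl').trans hle⟩
  have hpos : ∀ᶠ t : ℝ in 𝓝[>] 0, 0 < t := self_mem_nhdsWithin
  have hsmall : ∀ K δ : ℝ, 0 < δ → ∀ᶠ t : ℝ in 𝓝[>] 0, t * K < δ := fun K δ hδ => by
    refine Filter.Eventually.filter_mono nhdsWithin_le_nhds ?_
    have h1 : Tendsto (fun t : ℝ => t * K) (𝓝 0) (𝓝 0) :=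
      (continuous_id.mul continuous_const).tendsto' 0 0 (by simp)
    exact h1.eventually (gt_mem_nhds hδ)
  refine ⟨?_, ω, hω, ?_⟩
  · filter_upwards [hpos, hsmall 1 r hr] with t ht0 htr
    exact (hleast t ht0 (by linarith)).2.1
  rw [tendsto_order]
  constructor
  · intro c hc
    set K := 2 * (|ω| + 3 * C * γ)
    set B := C * (K + γ)
    -- Half of the gap `ω - c` is used to exclude small `β`, the other half to absorb the remainder
    -- `t * B`.
    obtain ⟨δ, hδ, hδ'⟩ := exists_pos_le_re hω.2 B (c := (c + ω) / 2) (by linarith)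
    filter_upwards [hpos, hsmall 1 r hr, hsmall 1 1 one_pos, hsmall (4 * C) 1 one_pos,
      hsmall K δ hδ, hsmall B ((ω - c) / 2) (by linarith)] with t ht0 htr ht1 htC htK htB
    obtain ⟨hl, -, hle⟩ := hleast t ht0 (by linarith)
    obtain ⟨α, β, hmem, hα0, hαK, hβ, hlow⟩ := hE.exists_lower hs₀ hs₁ hb ht0 (by linarith)
      (by linarith) (by linarith) hl.1 hle
    have h1 : (c + ω) / 2 < β := by
      by_contra! h2
      linarith [hδ' α β hmem hα0 hβ h2]
    rw [lt_div_iff₀ ht0]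
    have h3 : c < β - t * B := by linarith
    calc c * t < (β - t * B) * t := mul_lt_mul_of_pos_right h3 ht0
      _ = t * β - t ^ 2 * B := by ring
      _ ≤ _ := hlow
  · intro c hc
    filter_upwards [hpos, hsmall 1 r hr, hsmall (C * γ) (c - ω) (by linarith)] with t ht0 htr htc
    rw [div_lt_iff₀ ht0]
    calc _ ≤ t * ω + C * t ^ 2 * γ := (hleast t ht0 (by linarith)).2.2
      _ = (ω + t * (C * γ)) * t := by ring
      _ < c * t := mul_lt_mul_of_pos_right (by linarith) ht0
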